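/- Let $\Sigma$ be a finite alphabet and $\mathcal X$ a finite, linearly ordered set of variables; put $\Gamma_{\mathcal X}=\{\vdash_x,\dashv_x : x\in\mathcal X\}$. A span of a word (document) $D\in\Sigma^*$ is a pair $[i,j\rangle$ with $1\le i\le j\le |D|+1$; spans $[i,j\rangle,[i',j'\rangle$ are disjoint if $j\le i'$ or $j'\le i$. A multispan-tuple over $D$ and $\mathcal X$ maps every $x\in\mathcal X$ to a set of pairwise disjoint spans of $D$, and a multispanner $E$ maps every $D\in\Sigma^*$ to a set $E(D)$ of multispan-tuples over $D$ and $\mathcal X$. Multispanner-expressions are $R ::= \varepsilon \mid a\in\Sigma \mid (R\cdot R)\mid (R+R)\mid R^*\mid x\{R\}$, where $x\{R\}$ is allowed only if $x$ does not appear in $R$. The expression $R$ defines a language $L(R)\subseteq(\Sigma\cup\Gamma_{\mathcal X})^*$ in the usual way, with $L(x\{R\})=\{\vdash_x\}L(R)\{\dashv_x\}$. A word $w\in L(R)$ describes the document obtained by erasing all brackets, and the multispan-tuple that maps $x$ to the set of the spans enclosed by an occurrence of $\vdash_x$ and the next occurrence of $\dashv_x$. The multispanner $[\![R]\!]$ maps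 $D$ to the set of the tuples described by those $w\in L(R)$ whose document is $D$. A regex multispanner is one of the form $[\![R]\!]$. For a multispan-tuple $t$ over $D$ let $\langle t,D\rangle=t[1]D[1]t[2]D[2]\cdots D[|D|]\,t[|D|+1]$, where $t[i]$ is the concatenation, over $x\in\mathcal X$ in increasing order, of the words $(\dashv_x)^c(\vdash_x\dashv_x)^e(\vdash_x)^o$ with $c,e,o\in\{0,1\}$ and $c=1$ iff $[j,i\rangle\in t(x)$ for some $j\ne i$, $e=1$ iff $[i,i\rangle\in t(x)$, $o=1$ iff $[i,j\rangle\in t(x)$ for some $j\neq i$. An ET program with input alphabet $\Sigma$ and output alphabet $\Omega$ is a pair $(E,T)$ of a multispanner $E$ over $\Sigma$ and $\mathcal X$ (for some $\mathcal X$) and a partial function $T:(\Sigma\cup\Gamma_{\mathcal X})^*\rightharpoonup\Omega^*$. Its semantics maps $D\in\Sigma^*$ to the bag $[\![E\cdot T]\!](D)=\{\!\{T(\langle t,D\rangle) : t\in E(D),\ T(\langle t,D\rangle)\text{ defined}\}\!\}$. The program is linear if $E$ is a regex multispanner and $T$ is a linear polyregular (also called regular) string-to-string function, meaning that $T$ is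 defined by a deterministic streaming string transducer: a machine with finitely many states and registers, a partial deterministic transition function that attaches to each transition a copyless (partial) assignment of words over registers and output letters to the registers, all registers initially holding $\varepsilon$, and a partial final function that assigns to states output words over registers and output letters in which every register occurs at most once. **Theorem.** Let $\Sigma,\Omega,\Pi$ be finite alphabets, let $(E_1,T_1)$ be a linear ET program with input alphabet $\Sigma$ and output alphabet $\Omega$, and let $(E_2,T_2)$ be a linear ET program with input alphabet $\Omega$ and output alphabet $\Pi$. Then there is a linear ET program $(E,T)$ with input alphabet $\Sigma$ and output alphabet $\Pi$ such that for every $D\in\Sigma^*$ $$[\![E\cdot T]\!](D)=\bigcup_{D'\in[\![E_1\cdot T_1]\!](D)}[\![E_2\cdot T_2]\!](D')=[\![(E_1\cdot T_1)\circ(E_2\cdot T_2)]\!](D),$$ where $\bigcup$ is the additive union of bags, taken over all occurrences of $D'$ in the bag $[\![E_1\cdot T_1]\!](D)$. Moreover, $T$ can be chosen such that, for some constant $c$, $|T(w)|\le c\,|w|$ for all $w$ for which $T(w)$ is defined. -/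

import Mathlib

namespace ET

/-! ### Multispans and multispanners -/

/-- The alphabet `A ∪ Γ_X`: letters of `A` together with an opening and a closing bracket for
every variable of `X`. -/
inductive RefSym (A X : Type*) where
  | letter (a : A) : RefSym A X
  | opn (x : X) : RefSym A X
  | cls (x : X) : RefSym A X

/-- Spans of a document of length `n`: pairs `i ≤ j` of positions. Positions are counted from `0`,
so `(i, j)` stands for the factor made of the letters with (0-based) indices `i, …, j - 1`. -/
abbrev Span (n : ℕ) : Type := {p : Fin (n + 1) × Fin (n + 1) // p.1 ≤ p.2}

def Span.start {n : ℕ} (s : Span n) : Fin (n + 1) := s.1.1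

def Span.finish {n : ℕ} (s : Span n) : Fin (n + 1) := s.1.2

def Span.IsDisjoint {n : ℕ} (s s' : Span n) : Prop := s.finish ≤ s'.start ∨ s'.finish ≤ s.start

/-- A multispan is a set of pairwise disjoint spans. -/
def IsMultispan {n : ℕ} (S : Finset (Span n)) : Prop :=
  ∀ s ∈ S, ∀ s' ∈ S, s ≠ s' → s.IsDisjoint s'

/-- Multispan-tuples over a document of length `n` and the variables `X`. -/
abbrev MultispanTuple (n : ℕ) (X : Type*) : Type _ :=
  {t : X → Finset (Span n) // ∀ x, IsMultispan (t x)}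

/-- A multispanner maps every document to a set of multispan-tuples over this document. -/
abbrev Multispanner (A X : Type*) : Type _ :=
  (D : List A) → Set (MultispanTuple D.length X)

/-! ### Multiref-words -/

/-- The document described by a word over `A ∪ Γ_X`: erase all brackets. -/
def doc {A X : Type*} : List (RefSym A X) → List A
  | [] => []
  | .letter a :: w => a :: doc w
  | .opn _ :: w => doc w
  | .cls _ :: w => doc w

/-- A matching pair of brackets of `x` in `w` (an opening bracket and the next bracket of `x`, which
is a closing one) encloses the span from position `i` to position `j` of `doc w`. -/
def HasSpan {A X : Type*} (w : List (RefSym A X)) (x : X) (i j : ℕ) : Prop :=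
  ∃ u v z : List (RefSym A X),
    w = u ++ [RefSym.opn x] ++ v ++ [RefSym.cls x] ++ z ∧
    RefSym.opn x ∉ v ∧ RefSym.cls x ∉ v ∧
    i = (doc u).length ∧ j = (doc u).length + (doc v).length

/-- The multispanner described by a language `L` of multiref-words: it maps `D` to the set of the
multispan-tuples described by those `w ∈ L` with `doc w = D`. -/
def languageMultispanner {A X : Type*} (L : Language (RefSym A X)) : Multispanner A X :=
  fun D => {t | ∃ w ∈ L, doc w = D ∧ ∀ (x : X) (s : Span D.length),
    s ∈ t.1 x ↔ HasSpan w x s.start s.finish}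

/-! ### Regex multispanners -/

/-- Multispanner-expressions, before the side condition on variables is imposed. -/
inductive Expr (A X : Type*) where
  | eps : Expr A X
  | sym (a : A) : Expr A X
  | cat (R R' : Expr A X) : Expr A X
  | alt (R R' : Expr A X) : Expr A X
  | star (R : Expr A X) : Expr A X
  | bind (x : X) (R : Expr A X) : Expr A X

/-- The variable `x` appears in the expression. -/
def Expr.Mentions {A X : Type*} (x : X) : Expr A X → Prop
  | .eps => False
  | .sym _ => False
  | .cat R R' => R.Mentions x ∨ R'.Mentions x
  | .alt R R' => R.Mentions x ∨ R'.Mentions x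
  | .star R => R.Mentions x
  | .bind y R => x = y ∨ R.Mentions x

/-- The side condition of multispanner-expressions: `x{R}` is formed only if `x` does not appear
in `R`. -/
def Expr.WellFormed {A X : Type*} : Expr A X → Prop
  | .eps => True
  | .sym _ => True
  | .cat R R' => R.WellFormed ∧ R'.WellFormed
  | .alt R R' => R.WellFormed ∧ R'.WellFormed
  | .star R => R.WellFormed
  | .bind x R => ¬ R.Mentions x ∧ R.WellFormed

open scoped Computability in
/-- The language of multiref-words defined by an expression. -/
def Expr.lang {A X : Type*} : Expr A X → Language (RefSym A X)
  | .eps => 1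
  | .sym a => {[RefSym.letter a]}
  | .cat R R' => R.lang * R'.lang
  | .alt R R' => R.lang + R'.lang
  | .star R => R.lang∗
  | .bind x R => {[RefSym.opn x]} * R.lang * {[RefSym.cls x]}

def IsRegexMultispanner {A X : Type*} (E : Multispanner A X) : Prop :=
  ∃ R : Expr A X, R.WellFormed ∧ E = languageMultispanner R.lang

/-! ### The unique encoding of a multispan-tuple and a document as a multiref-word -/

/-- The word `t[i, x]`, of the form `(⊣x)^c (⊢x ⊣x)^e (⊢x)^o` with `c, e, o ∈ {0, 1}`. -/
def gapVar {A X : Type*} {n : ℕ} (t : MultispanTuple n X) (i : Fin (n + 1)) (x : X) :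
    List (RefSym A X) :=
  (if ∃ s ∈ t.1 x, s.finish = i ∧ s.start ≠ i then [RefSym.cls x] else []) ++
  (if ∃ s ∈ t.1 x, s.start = i ∧ s.finish = i then [RefSym.opn x, RefSym.cls x] else []) ++
  (if ∃ s ∈ t.1 x, s.start = i ∧ s.finish ≠ i then [RefSym.opn x] else [])

/-- The word `t[i]`: the concatenation of the words `t[i, x]`, with `x` ranging over the variables
in increasing order. -/
def gap {A X : Type*} [Fintype X] [LinearOrder X] {n : ℕ} (t : MultispanTuple n X)
    (i : Fin (n + 1)) : List (RefSym A X) :=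
  (Finset.univ.sort (fun x y : X => x ≤ y)).flatMap (fun x => gapVar t i x)

/-- The encoding `t[0] D[0] t[1] D[1] ⋯ D[n - 1] t[n]` of a document `D` of length `n` and a
multispan-tuple `t` over `D`. -/
def encode {A X : Type*} [Fintype X] [LinearOrder X] (D : List A)
    (t : MultispanTuple D.length X) : List (RefSym A X) :=
  (List.finRange D.length).flatMap (fun i => gap t i.castSucc ++ [RefSym.letter (D.get i)]) ++
    gap t (Fin.last D.length)

/-! ### Extract-transform programs -/

/-- A string-to-string function is a partial function on words; `none` means undefined. -/
abbrev StringFun (A B : Type*) : Type _ := List A → Option (List B)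

/-- An extract-transform program with input alphabet `A`, variables `X` and output alphabet `B`. -/
structure Program (A X B : Type*) where
  E : Multispanner A X
  T : StringFun (RefSym A X) B

/-- The bag of the words `T(⟨t, D⟩)` with `t ∈ E(D)`, each such `t` with `T(⟨t, D⟩)` defined
contributing one occurrence. -/
noncomputable def Program.eval {A X B : Type*} [Fintype X] [LinearOrder X]
    (P : Program A X B) (D : List A) : Multiset (List B) :=
  (Set.toFinite (P.E D)).toFinset.val.filterMap (fun t => P.T (encode D t))

/-- The semantics of the composition of two programs: the bag union of the bags `⟦P₂⟧(D')`, where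
every occurrence of a document `D'` in the bag `⟦P₁⟧(D)` contributes to the union. -/
noncomputable def compEval {A X₁ B X₂ C : Type*} [Fintype X₁] [LinearOrder X₁]
    [Fintype X₂] [LinearOrder X₂] (P₁ : Program A X₁ B) (P₂ : Program B X₂ C)
    (D : List A) : Multiset (List C) :=
  (P₁.eval D).bind (fun D' => P₂.eval D')

/-! ### Deterministic streaming string transducers -/

/-- Assignments: partial functions from registers to words over registers and output letters. -/
abbrev Assignment (R B : Type*) : Type _ := R → Option (List (R ⊕ B))

/-- Valuations: assignments without registers on the right-hand side. -/
abbrev Valuation (R B : Type*) : Type _ := R → Option (List B)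

/-- An assignment is copyless if every register occurs at most once in all its right-hand sides
together. -/
def Assignment.Copyless {R B : Type*} [Fintype R] [DecidableEq R] (σ : Assignment R B) : Prop :=
  ∀ X : R, ∑ Y : R, ((σ Y).getD []).countP (fun c => c.getLeft? = some X) ≤ 1

/-- The extension of a valuation to words over registers and letters; it is undefined as soon as
some register of the word has no value. -/
def Valuation.extend {R B : Type*} (ν : Valuation R B) : List (R ⊕ B) → Option (List B)
  | [] => some []
  | .inl X :: w => (ν X).bind fun u => (Valuation.extend ν w).map fun v => u ++ v
  | .inr b :: w => (Valuation.extend ν w).map fun v => b :: v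

/-- The valuation `ν ∘ σ`. -/
def Valuation.comp {R B : Type*} (ν : Valuation R B) (σ : Assignment R B) : Valuation R B :=
  fun X => (σ X).bind fun w => ν.extend w

/-- Deterministic streaming string transducers with input alphabet `A` and output alphabet `B`. -/
structure DSST (A B : Type*) where
  /-- states -/
  Q : Type
  /-- registers -/
  R : Type
  [finQ : Fintype Q]
  [finR : Fintype R]
  [decR : DecidableEq R]
  /-- partial transition function -/
  Δ : Q → A → Option (Assignment R B × Q)
  copyless : ∀ q a σ q', Δ q a = some (σ, q') → σ.Copyless
  /-- initial state -/
  q₀ : Q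
  /-- partial final function -/
  F : Q → Option (List (R ⊕ B))
  final_once : ∀ q w, F q = some w → ∀ X : R, w.countP (fun c => c.getLeft? = some X) ≤ 1

/-- The output of the run on the given word that starts in the configuration `(q, ν)`, if there is
such a run and it is accepting. -/
def DSST.evalFrom {A B : Type*} (𝒯 : DSST A B) :
    List A → 𝒯.Q → Valuation 𝒯.R B → Option (List B)
  | [], q, ν => (𝒯.F q).bind fun w => ν.extend w
  | a :: w, q, ν => (𝒯.Δ q a).bind fun p => DSST.evalFrom 𝒯 w p.2 (ν.comp p.1)

/-- The string-to-string function defined by a DSST; initially all registers hold the empty word. -/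
def DSST.eval {A B : Type*} (𝒯 : DSST A B) : StringFun A B :=
  fun w => 𝒯.evalFrom w 𝒯.q₀ (fun _ => some [])

/-! ### Linear programs -/

/-- The length of the output is bounded by a constant multiple of the length of the input. -/
def HasLinearGrowth {A B : Type*} (T : StringFun A B) : Prop :=
  ∃ c : ℕ, ∀ w v, T w = some v → v.length ≤ c * w.length

/-- A linear ET program consists of a regex multispanner and a string-to-string function defined by
a deterministic streaming string transducer. -/
def Program.IsLinear {A X B : Type*} (P : Program A X B) : Prop :=
  IsRegexMultispanner P.E ∧ ∃ 𝒯 : DSST (RefSym A X) B, P.T = 𝒯.eval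

end ET

/-!
A linear ET program has the same expressive power as a streaming string transducer that chooses its
transitions nondeterministically and outputs the bag of the results of all its runs. Such a
transducer can guess the labels of all gaps of a document, simulate the deterministic transducer of
a program on the resulting encoding, and check with the set of states reachable in an automaton for
the expression that the guessed labels are those of a word of the language; hence every tuple
accounts for exactly one family of runs. Conversely, an expression can allow one arbitrary marker
at every position of the document, and the marker can determine the transition to take.

These transducers are closed under composition. To run `N₂` on the output of `N₁`, guess for each
register of `N₁` that is still to be used, in the order of use, the pair of states between which
the run of `N₂` leads on its content. As `N₁` is copyless, each content is read at most once, so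
these claims form a queue of bounded length. The effect of a claimed run on the registers of `N₂` is
an assignment with contents in the output alphabet; only its shape is kept in the state, and the
words of letters between consecutive registers are stored in new registers.
-/
namespace ET

/-! ### Partial substitutions -/

section Words

variable {L M N R B G G' : Type*}

/-- The extension of a partial map from letters to words to a partial map on words. -/
def subst (k : L → Option (List M)) : List L → Option (List M)
  | [] => some []
  | x :: w => (k x).bind fun u => (subst k w).map fun v => u ++ v

theorem subst_append (k : L → Option (List M)) (u v : List L) :
    subst k (u ++ v) = (subst k u).bind fun u' => (subst k v).map fun v' => u' ++ v' := by
  induction u with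
  | nil => cases h : subst k v <;> simp [subst, h]
  | cons x u ih =>
    simp only [List.cons_append, subst, ih]
    cases k x <;> cases subst k u <;> cases subst k v <;> simp

theorem subst_bind_subst (k : L → Option (List M)) (k' : M → Option (List N)) (w : List L) :
    (subst k w).bind (subst k') = subst (fun x => (k x).bind (subst k')) w := by
  induction w with
  | nil => rfl
  | cons x w ih =>
    simp only [subst, ← ih]
    cases k x with
    | none => rfl
    | some u => cases subst k w <;> simp [subst_append, Option.map]

theorem subst_some_singleton (f : L → M) (w : List L) :
    subst (fun x => some [f x]) w = some (w.map f) := by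
  induction w with
  | nil => rfl
  | cons x w ih => simp [subst, ih]

theorem subst_map (f : L → M) (k : M → Option (List N)) (w : List L) :
    subst k (w.map f) = subst (k ∘ f) w := by
  induction w with
  | nil => rfl
  | cons x w ih => simp [subst, ih]

/-- The registers of a word, from left to right. -/
def regs (w : List (R ⊕ G)) : List R := w.filterMap Sum.getLeft?

/-- The letters of a word, from left to right; also the value of the word when all registers are
empty. -/
def letters (w : List (R ⊕ G)) : List G := w.filterMap Sum.getRight?

@[simp] theorem regs_nil : regs ([] : List (R ⊕ G)) = [] := rfl

@[simp] theorem regs_inl_cons (X : R) (w : List (R ⊕ G)) : regs (.inl X :: w) = X :: regs w := rfl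

@[simp] theorem regs_inr_cons (g : G) (w : List (R ⊕ G)) : regs (.inr g :: w) = regs w := rfl

@[simp] theorem regs_append (u v : List (R ⊕ G)) : regs (u ++ v) = regs u ++ regs v :=
  List.filterMap_append

@[simp] theorem letters_nil : letters ([] : List (R ⊕ G)) = [] := rfl

@[simp] theorem letters_inl_cons (X : R) (w : List (R ⊕ G)) :
    letters (.inl X :: w) = letters w := rfl

@[simp] theorem letters_inr_cons (g : G) (w : List (R ⊕ G)) :
    letters (.inr g :: w) = g :: letters w := rfl

@[simp] theorem letters_append (u v : List (R ⊕ G)) :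
    letters (u ++ v) = letters u ++ letters v :=
  List.filterMap_append

@[simp] theorem letters_map_inr (w : List G) : letters (w.map (.inr : G → R ⊕ G)) = w := by
  simp [letters, List.filterMap_map, Function.comp_def]

@[simp] theorem regs_map_inr (w : List G) : regs (w.map (.inr : G → R ⊕ G)) = [] := by
  simp [regs, List.filterMap_map, Function.comp_def]

@[simp] theorem regs_map_sumMap (ι : G → G') (w : List (R ⊕ G)) :
    regs (w.map (Sum.map id ι)) = regs w := by
  rw [regs, List.filterMap_map]
  congr 1
  funext x
  cases x <;> rfl

@[simp] theorem letters_map_sumMap (ι : G → G') (w : List (R ⊕ G)) :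
    letters (w.map (Sum.map id ι)) = (letters w).map ι := by
  rw [letters, letters, List.filterMap_map, List.map_filterMap]
  congr 1
  funext x
  cases x <;> rfl

theorem count_regs [DecidableEq R] (X : R) (w : List (R ⊕ G)) :
    (regs w).count X = w.countP (fun c => c.getLeft? = some X) := by
  induction w with
  | nil => rfl
  | cons x w ih => cases x <;> simp [List.count_cons, List.countP_cons, ih]

theorem nodup_regs_iff [DecidableEq R] (w : List (R ⊕ G)) :
    (regs w).Nodup ↔ ∀ X, w.countP (fun c => c.getLeft? = some X) ≤ 1 := by
  simp only [List.nodup_iff_count_le_one, count_regs]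

/-- Substitute the letters of a word and keep its registers. -/
def replaceLetters (θ : G → Option (List G')) : List (R ⊕ G) → Option (List (R ⊕ G')) :=
  subst (Sum.elim (fun X => some [.inl X]) fun g => (θ g).map (List.map .inr))

theorem map_letters_replaceLetters (θ : G → Option (List G')) (w : List (R ⊕ G)) :
    (replaceLetters θ w).map letters = subst θ (letters w) := by
  induction w with
  | nil => rfl
  | cons x w ih =>
    cases x with
    | inl X => simp [replaceLetters, subst, ← ih, Function.comp_def]
    | inr g =>
      simp only [replaceLetters, subst, Sum.elim_inr, letters_inr_cons, ← ih]
      cases θ g <;> simp [Function.comp_def]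

end Words

/-! ### Assignments -/

section Assignments

variable {R G G' : Type*}

namespace Assignment

/-- The word obtained by replacing every register by its value; undefined as soon as some register
of the word has no value. -/
def apply (α : Assignment R G) : List (R ⊕ G) → Option (List (R ⊕ G)) :=
  subst (Sum.elim α fun g => some [.inr g])

/-- The assignment that leaves all registers unchanged. -/
def identity : Assignment R G := fun X => some [.inl X]

/-- The assignment with the same effect as `α` followed by `β`. -/
def comp (α β : Assignment R G) : Assignment R G := fun X => (β X).bind α.apply

/-- Rename the letters of an assignment. -/
def mapLetters (ι : G → G') (α : Assignment R G) : Assignment R G' :=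
  fun X => (α X).map (List.map (Sum.map id ι))

/-- Substitute the letters of an assignment. -/
def substLetters (θ : G → Option (List G')) (α : Assignment R G) : Assignment R G' :=
  fun X => (α X).bind (replaceLetters θ)

@[simp] theorem apply_nil (α : Assignment R G) : α.apply [] = some [] := rfl

theorem apply_inl_cons (α : Assignment R G) (X : R) (w : List (R ⊕ G)) :
    α.apply (.inl X :: w) = (α X).bind fun u => (α.apply w).map fun v => u ++ v := rfl

theorem apply_inr_cons (α : Assignment R G) (g : G) (w : List (R ⊕ G)) :
    α.apply (.inr g :: w) = (α.apply w).map fun v => .inr g :: v := rfl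

theorem apply_map_inr (α : Assignment R G) (w : List G) :
    α.apply (w.map .inr) = some (w.map .inr) := by
  rw [apply, subst_map]
  exact subst_some_singleton _ w

theorem apply_identity : (identity : Assignment R G).apply = some := by
  funext w
  have h : Sum.elim identity (fun g : G => some [.inr g]) = fun x : R ⊕ G => some [x] := by
    funext x; cases x <;> rfl
  rw [apply, h]
  exact (subst_some_singleton id w).trans (by rw [List.map_id])

theorem apply_comp (α β : Assignment R G) (w : List (R ⊕ G)) :
    (comp α β).apply w = (β.apply w).bind α.apply := by
  rw [apply, apply, apply, subst_bind_subst]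
  congr 1
  funext x
  cases x <;> simp [comp, apply, subst]

theorem apply_const_nil (w : List (R ⊕ G)) :
    apply (fun _ : R => some []) w = some ((letters w).map .inr) := by
  induction w with
  | nil => rfl
  | cons x w ih => cases x <;> simp [apply_inl_cons, apply_inr_cons, ih]

theorem apply_mapLetters (ι : G → G') (α : Assignment R G) (w : List (R ⊕ G)) :
    (α.mapLetters ι).apply (w.map (Sum.map id ι)) =
      (α.apply w).map (List.map (Sum.map id ι)) := by
  induction w with
  | nil => rfl
  | cons x w ih =>
    cases x with
    | inl X =>
      cases h : α X <;> simp [apply_inl_cons, mapLetters, h, ih, Function.comp_def]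
    | inr g => simp [apply_inr_cons, ih, Function.comp_def]

theorem apply_bind_replaceLetters (θ : G → Option (List G')) (α : Assignment R G)
    (w : List (R ⊕ G)) :
    (α.apply w).bind (replaceLetters θ) = (replaceLetters θ w).bind (α.substLetters θ).apply := by
  rw [apply, apply, replaceLetters, subst_bind_subst, subst_bind_subst]
  congr 1
  funext x
  cases x with
  | inl X => simp [subst, substLetters, replaceLetters]
  | inr g =>
    cases h : θ g with
    | none => simp [subst, h]
    | some u =>
      have hu := apply_map_inr (α.substLetters θ) u
      rw [apply] at hu
      simp [subst, h, hu]

end Assignment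

theorem replaceLetters_map {H : Type*} {θ : G → Option (List G')} {ι : H → G} {ι' : H → G'}
    (hθ : ∀ c, θ (ι c) = some [ι' c]) (w : List (R ⊕ H)) :
    replaceLetters θ (w.map (Sum.map id ι)) = some (w.map (Sum.map id ι')) := by
  rw [replaceLetters, subst_map, ← subst_some_singleton]
  congr 1
  funext x
  cases x <;> simp [hθ]

theorem Assignment.substLetters_mapLetters {H : Type*} {θ : G → Option (List G')} {ι : H → G}
    {ι' : H → G'} (hθ : ∀ c, θ (ι c) = some [ι' c]) (σ : Assignment R H) :
    (σ.mapLetters ι).substLetters θ = σ.mapLetters ι' := by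
  funext X
  cases h : σ X <;> simp [substLetters, mapLetters, h, replaceLetters_map hθ]

theorem Valuation.extend_eq_subst (ν : Valuation R G) (w : List (R ⊕ G)) :
    ν.extend w = subst (Sum.elim ν fun g => some [g]) w := by
  induction w with
  | nil => rfl
  | cons x w ih => cases x <;> simp [Valuation.extend, subst, ih]

theorem Valuation.extend_comp (ν : Valuation R G) (α : Assignment R G) (w : List (R ⊕ G)) :
    (ν.comp α).extend w = (α.apply w).bind ν.extend := by
  rw [funext ν.extend_eq_subst, Valuation.extend_eq_subst, Assignment.apply, subst_bind_subst]
  congr 1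
  funext x
  cases x with
  | inl X => simp [Valuation.comp, funext ν.extend_eq_subst]
  | inr g => simp [subst]

theorem Valuation.extend_const_nil (w : List (R ⊕ G)) :
    Valuation.extend (fun _ => some []) w = some (letters w) := by
  induction w with
  | nil => rfl
  | cons x w ih => cases x <;> simp [Valuation.extend, ih]

end Assignments

end ET

/-! ### Copyless assignments -/

namespace ET

theorem bind_le_bind {L M : Type*} {s : Multiset L} {f g : L → Multiset M}
    (h : ∀ x ∈ s, f x ≤ g x) : s.bind f ≤ s.bind g :=
  Multiset.sum_map_le_sum_map f g h

theorem bind_le_bind_univ {R M : Type*} [Fintype R] {s : Multiset R} (hs : s.Nodup)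
    (f : R → Multiset M) : s.bind f ≤ Finset.univ.val.bind f :=
  Finset.sum_le_sum_of_subset (f := f) (Finset.subset_univ ⟨s, hs⟩)

theorem bind_univ_eq_of_unique {α β : Type*} [Fintype α] {f : α → Multiset β} (a : α)
    (h : ∀ b, b ≠ a → f b = 0) : Finset.univ.val.bind f = f a :=
  Fintype.sum_eq_single a h

namespace Assignment

variable {R G G' : Type*}

/-- The right-hand side of an assignment for a register, with the empty word in place of an
undefined one. -/
def rhs (α : Assignment R G) (X : R) : List (R ⊕ G) := (α X).getD []

theorem regs_of_apply (α : Assignment R G) {w v : List (R ⊕ G)} (h : α.apply w = some v) :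
    regs v = (regs w).flatMap fun X => regs (α.rhs X) := by
  induction w generalizing v with
  | nil => simp_all
  | cons x w ih =>
    cases x with
    | inl X =>
      simp only [apply_inl_cons, Option.bind_eq_some_iff, Option.map_eq_some_iff] at h
      obtain ⟨u, hu, v, hv, rfl⟩ := h
      simp [ih hv, rhs, hu]
    | inr g =>
      simp only [apply_inr_cons, Option.map_eq_some_iff] at h
      obtain ⟨v, hv, rfl⟩ := h
      simp [ih hv]

theorem coe_regs_of_apply (α : Assignment R G) {w v : List (R ⊕ G)} (h : α.apply w = some v) :
    (regs v : Multiset R) = (regs w : Multiset R).bind fun X => regs (α.rhs X) := by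
  rw [α.regs_of_apply h, Multiset.coe_bind]

theorem coe_letters_of_apply (α : Assignment R G) {w v : List (R ⊕ G)}
    (h : α.apply w = some v) :
    (letters v : Multiset G) =
      letters w + (regs w : Multiset R).bind fun X => (letters (α.rhs X) : Multiset G) := by
  induction w generalizing v with
  | nil => simp_all
  | cons x w ih =>
    cases x with
    | inl X =>
      simp only [apply_inl_cons, Option.bind_eq_some_iff, Option.map_eq_some_iff] at h
      obtain ⟨u, hu, v, hv, rfl⟩ := h
      rw [letters_append, ← Multiset.coe_add, ih hv, letters_inl_cons, regs_inl_cons,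
        ← Multiset.cons_coe, Multiset.cons_bind, rhs, hu, Option.getD_some,
        add_left_comm]
    | inr g =>
      simp only [apply_inr_cons, Option.map_eq_some_iff] at h
      obtain ⟨v, hv, rfl⟩ := h
      rw [letters_inr_cons, letters_inr_cons, ← Multiset.cons_coe, ← Multiset.cons_coe, ih hv,
        Multiset.cons_add, regs_inr_cons]

theorem rhs_comp (α β : Assignment R G) (X : R) :
    (comp α β).rhs X = (α.apply (β.rhs X)).getD [] := by
  cases h : β X <;> simp [rhs, comp, h]

variable [Fintype R]

/-- The occurrences of registers on the right-hand sides of an assignment. -/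
def regs (α : Assignment R G) : Multiset R :=
  Finset.univ.val.bind fun X => ET.regs (α.rhs X)

/-- The occurrences of letters on the right-hand sides of an assignment. -/
def letters (α : Assignment R G) : Multiset G :=
  Finset.univ.val.bind fun X => ET.letters (α.rhs X)

theorem copyless_iff_nodup_regs [DecidableEq R] {α : Assignment R G} :
    α.Copyless ↔ α.regs.Nodup := by
  have count (X : R) : α.regs.count X = ∑ Y, (ET.regs (α.rhs Y)).count X := by
    simp only [regs, Multiset.count_bind, Multiset.coe_count]
    rfl
  simp only [Copyless, Multiset.nodup_iff_count_le_one, count, count_regs, rhs]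

theorem coe_regs_rhs_le (α : Assignment R G) (X : R) :
    (ET.regs (α.rhs X) : Multiset R) ≤ α.regs :=
  Multiset.le_bind _ (Finset.mem_univ X)

theorem regs_identity : (identity : Assignment R G).regs = Finset.univ.val :=
  Multiset.bind_singleton _ _ |>.trans (Multiset.map_id _)

theorem letters_identity : (identity : Assignment R G).letters = 0 :=
  Multiset.bind_zero _

theorem regs_mapLetters (ι : G → G') (α : Assignment R G) : (α.mapLetters ι).regs = α.regs := by
  refine Multiset.bind_congr fun X _ => ?_
  cases h : α X <;> simp [rhs, mapLetters, h]

theorem letters_mapLetters (ι : G → G') (α : Assignment R G) :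
    (α.mapLetters ι).letters = α.letters.map ι := by
  rw [letters, letters, Multiset.map_bind]
  refine Multiset.bind_congr fun X _ => ?_
  cases h : α X <;> simp [rhs, mapLetters, h]

theorem regs_comp_le (α : Assignment R G) {β : Assignment R G} (hβ : β.regs.Nodup) :
    (comp α β).regs ≤ α.regs :=
  calc (comp α β).regs
    _ ≤ Finset.univ.val.bind fun X =>
          (ET.regs (β.rhs X) : Multiset R).bind fun Z => ET.regs (α.rhs Z) := by
      refine bind_le_bind fun X _ => ?_
      rw [rhs_comp]
      cases h : α.apply (β.rhs X) with
      | none => exact Multiset.zero_le _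
      | some v => exact (α.coe_regs_of_apply h).le
    _ = β.regs.bind fun Z => ET.regs (α.rhs Z) := (Multiset.bind_assoc ..).symm
    _ ≤ α.regs := bind_le_bind_univ hβ _

theorem letters_comp_le (α : Assignment R G) {β : Assignment R G} (hβ : β.regs.Nodup) :
    (comp α β).letters ≤ α.letters + β.letters :=
  calc (comp α β).letters
    _ ≤ Finset.univ.val.bind fun X => (ET.letters (β.rhs X) : Multiset G) +
          (ET.regs (β.rhs X) : Multiset R).bind fun Z => ET.letters (α.rhs Z) := by
      refine bind_le_bind fun X _ => ?_
      rw [rhs_comp]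
      cases h : α.apply (β.rhs X) with
      | none => exact Multiset.zero_le _
      | some v => exact (α.coe_letters_of_apply h).le
    _ = β.letters + β.regs.bind fun Z => ET.letters (α.rhs Z) := by
      rw [Multiset.bind_add, ← Multiset.bind_assoc, letters, regs]
    _ ≤ β.letters + α.letters := by
      gcongr
      exact bind_le_bind_univ hβ _
    _ = α.letters + β.letters := add_comm _ _

theorem nodup_regs_of_apply {α : Assignment R G} (hα : α.regs.Nodup) {w v : List (R ⊕ G)}
    (hw : (ET.regs w).Nodup) (h : α.apply w = some v) : (ET.regs v).Nodup := by
  rw [← Multiset.coe_nodup, α.coe_regs_of_apply h]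
  exact Multiset.nodup_of_le (bind_le_bind_univ (Multiset.coe_nodup.2 hw) _) hα

theorem letters_le_of_apply (α : Assignment R G) {w v : List (R ⊕ G)}
    (hw : (ET.regs w).Nodup) (h : α.apply w = some v) :
    (ET.letters v : Multiset G) ≤ ET.letters w + α.letters := by
  rw [α.coe_letters_of_apply h]
  gcongr
  exact bind_le_bind_univ (Multiset.coe_nodup.2 hw) _

end Assignment

end ET

/-! ### Nondeterministic streaming string transducers -/

namespace ET

/-- Nondeterministic streaming string transducers: like `DSST`, with a bag of transitions for every
state and letter and a bag of final words for every state. Since the semantics is a bag, equal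
transitions count separately. -/
structure NSST (A B : Type*) where
  Q : Type
  R : Type
  [finQ : Fintype Q]
  [finR : Fintype R]
  [decR : DecidableEq R]
  δ : Q → A → Multiset (Assignment R B × Q)
  copyless : ∀ q a, ∀ r ∈ δ q a, r.1.regs.Nodup
  q₀ : Q
  F : Q → Multiset (List (R ⊕ B))
  final_once : ∀ q, ∀ w ∈ F q, (regs w).Nodup

namespace NSST

attribute [instance] NSST.finQ NSST.finR NSST.decR

variable {A B : Type*} (N : NSST A B)

/-- The bag of the outputs of all runs from a state, as words over the output letters and the
initial contents of the registers. -/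
def symbolicOutputs : List A → N.Q → Multiset (List (N.R ⊕ B))
  | [], q => N.F q
  | a :: w, q => (N.δ q a).bind fun r => (symbolicOutputs w r.2).filterMap r.1.apply

/-- The bag of the outputs of all runs; initially all registers hold the empty word. -/
def eval (w : List A) : Multiset (List B) :=
  (N.symbolicOutputs w N.q₀).map letters

theorem nodup_regs_of_mem_symbolicOutputs (w : List A) (q : N.Q) :
    ∀ v ∈ N.symbolicOutputs w q, (regs v).Nodup := by
  induction w generalizing q with
  | nil => exact N.final_once q
  | cons a w ih =>
    simp only [symbolicOutputs, Multiset.mem_bind, Multiset.mem_filterMap]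
    rintro v ⟨r, hr, u, hu, huv⟩
    exact Assignment.nodup_regs_of_apply (N.copyless q a r hr) (ih r.2 u hu) huv

end NSST

/-! ### Runs on words with claims about register contents -/

/-- A claim about the content of a register: some run of a transducer on it leads from `source` to
`target` and has the given effect on the registers of the transducer. -/
structure Claim (S Q T : Type*) where
  register : S
  source : Q
  target : Q
  effect : T

namespace Claim

variable {S Q T T' : Type*}

/-- Apply a function to the effect of a claim. -/
def map (f : T → T') (e : Claim S Q T) : Claim S Q T' :=
  ⟨e.register, e.source, e.target, f e.effect⟩

instance [Finite S] [Finite Q] [Finite T] : Finite (Claim S Q T) :=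
  Finite.of_injective (fun e => (e.register, e.source, e.target, e.effect))
    fun ⟨_, _, _, _⟩ ⟨_, _, _, _⟩ h => by simp_all

end Claim

namespace NSST

variable {B C S P : Type*} (N : NSST B C)

/-- Claims about runs of `N` on the contents of registers from `S`. The output words in the effects
may have holes from `P`, which stand for words that are not known yet. -/
abbrev RunClaim (S P : Type*) : Type _ := Claim S N.Q (Assignment N.R (P ⊕ C))

/-- Claims about register contents in the order in which the registers are to be read. -/
abbrev Queue (S P : Type*) : Type _ := List (N.RunClaim S P)

open Classical in
/-- One step of a run on a word over registers and letters. A register can only be read if it is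
the one in the first claim of the queue and the state is the source of this claim. -/
noncomputable def step :
    S ⊕ B → N.Q × N.Queue S P → Multiset (Assignment N.R (P ⊕ C) × N.Q × N.Queue S P)
  | .inr b, s => (N.δ s.1 b).map fun r => (r.1.mapLetters .inr, r.2, s.2)
  | .inl _, (_, []) => 0
  | .inl Y, (p, e :: E) =>
    if e.register = Y ∧ e.source = p then {(e.effect, e.target, E)} else 0

/-- Runs on a word over registers and letters, with their total effect and the configurations in
which they end. -/
noncomputable def runs : List (S ⊕ B) → N.Q × N.Queue S P →
    Multiset (Assignment N.R (P ⊕ C) × N.Q × N.Queue S P)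
  | [], s => {(Assignment.identity, s)}
  | x :: w, s => (N.step x s).bind fun r => (runs w r.2).map fun r' => (r.1.comp r'.1, r'.2)

/-- The bag of the outputs of the runs from a configuration that use up the queue, as words over the
output letters, the holes and the initial contents of the registers. -/
noncomputable def outputsFrom :
    List (S ⊕ B) → N.Q × N.Queue S P → Multiset (List (N.R ⊕ (P ⊕ C)))
  | [], (p, []) => (N.F p).map (List.map (Sum.map id .inr))
  | [], (_, _ :: _) => 0
  | x :: w, s => (N.step x s).bind fun r => (outputsFrom w r.2).filterMap r.1.apply

theorem outputsFrom_append (u v : List (S ⊕ B)) (s : N.Q × N.Queue S P) :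
    N.outputsFrom (u ++ v) s =
      (N.runs u s).bind fun r => (N.outputsFrom v r.2).filterMap r.1.apply := by
  induction u generalizing s with
  | nil => simp [runs, Assignment.apply_identity]
  | cons x u ih =>
    simp only [List.cons_append, outputsFrom, runs, ih, Multiset.bind_assoc, Multiset.bind_map,
      Multiset.filterMap_bind, Multiset.filterMap_filterMap, funext (Assignment.apply_comp _ _)]

theorem outputsFrom_inr_cons (b : B) (w : List (S ⊕ B)) (p : N.Q) (E : N.Queue S P) :
    N.outputsFrom (.inr b :: w) (p, E) = (N.δ p b).bind fun r =>
      (N.outputsFrom w (r.2, E)).filterMap (r.1.mapLetters .inr).apply := by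
  rw [outputsFrom, step, Multiset.bind_map]

theorem outputsFrom_inl_cons (Y : S) (w : List (S ⊕ B)) (e : N.RunClaim S P) (E : N.Queue S P)
    (h : e.register = Y) :
    N.outputsFrom (.inl Y :: w) (e.source, e :: E) =
      (N.outputsFrom w (e.target, E)).filterMap e.effect.apply := by
  simp [outputsFrom, step, h]

theorem outputsFrom_map_inr (w : List B) (p : N.Q) :
    N.outputsFrom (w.map .inr) (p, ([] : N.Queue S P)) =
      (N.symbolicOutputs w p).map (List.map (Sum.map id .inr)) := by
  induction w generalizing p with
  | nil => rfl
  | cons b w ih =>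
    simp only [List.map_cons, outputsFrom_inr_cons, ih, symbolicOutputs, Multiset.map_bind,
      Multiset.filterMap_map, Multiset.map_filterMap, Function.comp_def,
      Assignment.apply_mapLetters]

theorem outputsFrom_eq_zero (w : List (S ⊕ B)) (p : N.Q) (E : N.Queue S P)
    (h : E.map Claim.register ≠ regs w) : N.outputsFrom w (p, E) = 0 := by
  induction w generalizing p E with
  | nil => cases E <;> simp_all [outputsFrom]
  | cons x w ih =>
    refine (Multiset.bind_congr (g := fun _ => 0) fun r hr => ?_).trans (Multiset.bind_zero _)
    rw [ih, Multiset.filterMap_zero]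
    cases x with
    | inr b =>
      obtain ⟨_, _, rfl⟩ := Multiset.mem_map.1 hr
      exact h
    | inl Y =>
      cases E with
      | nil => simp [step] at hr
      | cons e E =>
        simp only [step] at hr
        split_ifs at hr with he
        · simp_all
        · simp at hr

/-! ### Claims after an assignment -/

/-- The queues of claims about the contents of the given registers after the assignment `σ` that
follow from the given claims about their contents before the assignment, all of which have to be
used. -/
noncomputable def choices (σ : Assignment S B) : List S → N.Queue S P → Multiset (N.Queue S P)
  | [], [] => {[]}
  | [], _ :: _ => 0
  | Y :: ys, E => (Finset.univ.val (α := N.Q)).bind fun p =>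
      ((σ Y).elim 0 fun w => N.runs w (p, E)).bind fun r =>
        (choices σ ys r.2.2).map fun E' => ⟨Y, p, r.2.1, r.1⟩ :: E'

theorem elim_apply_inr_cons (σ : Assignment S B) (b : B) (f : List (S ⊕ B)) (p : N.Q)
    (E : N.Queue S P) :
    ((σ.apply (.inr b :: f)).elim 0 fun w => N.outputsFrom w (p, E)) =
      (N.δ p b).bind fun r => ((σ.apply f).elim 0 fun w =>
        N.outputsFrom w (r.2, E)).filterMap (r.1.mapLetters .inr).apply := by
  rw [Assignment.apply_inr_cons]
  cases σ.apply f with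
  | none => simp
  | some w => exact N.outputsFrom_inr_cons b w p E

theorem elim_apply_inl_cons (σ : Assignment S B) (Y : S) (f : List (S ⊕ B)) (p : N.Q)
    (E : N.Queue S P) :
    ((σ.apply (.inl Y :: f)).elim 0 fun w => N.outputsFrom w (p, E)) =
      ((σ Y).elim 0 fun w => N.runs w (p, E)).bind fun r =>
        ((σ.apply f).elim 0 fun w => N.outputsFrom w r.2).filterMap r.1.apply := by
  rw [Assignment.apply_inl_cons]
  cases σ Y with
  | none => simp
  | some u =>
    cases σ.apply f with
    | none => simp
    | some w => exact N.outputsFrom_append u w (p, E)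

theorem elim_apply_outputsFrom (σ : Assignment S B) (f : List (S ⊕ B)) (p : N.Q)
    (E : N.Queue S P) :
    ((σ.apply f).elim 0 fun w => N.outputsFrom w (p, E)) =
      (N.choices σ (regs f) E).bind fun E' => N.outputsFrom f (p, E') := by
  induction f generalizing p E with
  | nil => cases E <;> simp [choices, outputsFrom]
  | cons x f ih =>
    cases x with
    | inr b =>
      simp only [N.elim_apply_inr_cons, ih, regs_inr_cons, outputsFrom_inr_cons,
        Multiset.filterMap_bind]
      exact Multiset.bind_bind _ _
    | inl Y =>
      rw [regs_inl_cons, choices, Multiset.bind_assoc, bind_univ_eq_of_unique p,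
        N.elim_apply_inl_cons, Multiset.bind_assoc]
      · refine Multiset.bind_congr fun r _ => ?_
        rw [ih, Multiset.bind_map, Multiset.filterMap_bind]
        exact Multiset.bind_congr fun E' _ =>
          (N.outputsFrom_inl_cons Y f ⟨Y, p, r.2.1, r.1⟩ E' rfl).symm
      · intro p' hp'
        simp [outputsFrom, step, hp', Multiset.bind_assoc, Multiset.bind_map]

/-! ### Filling holes -/

/-- The substitution of output words for the holes of a word. -/
def fill (κ : Assignment P C) : P ⊕ C → Option (List (P ⊕ C)) :=
  Sum.elim κ fun c => some [.inr c]

/-- Substitute words for the holes in the effects of a queue of claims. -/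
def fillQueue (κ : Assignment P C) (E : N.Queue S P) : N.Queue S P :=
  E.map (Claim.map (Assignment.substLetters (fill κ)))

theorem step_fillQueue (κ : Assignment P C) (x : S ⊕ B) (p : N.Q) (E : N.Queue S P) :
    N.step x (p, N.fillQueue κ E) = (N.step x (p, E)).map fun r =>
      (r.1.substLetters (fill κ), r.2.1, N.fillQueue κ r.2.2) := by
  cases x with
  | inr b =>
    simp [step, Assignment.substLetters_mapLetters (θ := fill κ) (ι := .inr) fun _ => rfl]
  | inl Y =>
    cases E with
    | nil => rfl
    | cons e E =>
      by_cases h : e.register = Y ∧ e.source = p <;> simp [step, fillQueue, Claim.map, h]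

theorem outputsFrom_fillQueue (κ : Assignment P C) (w : List (S ⊕ B)) (p : N.Q)
    (E : N.Queue S P) :
    N.outputsFrom w (p, N.fillQueue κ E) =
      (N.outputsFrom w (p, E)).filterMap (replaceLetters (fill κ)) := by
  induction w generalizing p E with
  | nil =>
    cases E with
    | nil =>
      simp only [fillQueue, List.map_nil, outputsFrom, Multiset.filterMap_map, Function.comp_def,
        replaceLetters_map (θ := fill κ) (ι := .inr) fun _ => rfl]
      exact (congrFun (Multiset.filterMap_eq_map _) _).symm
    | cons => rfl
  | cons x w ih =>
    simp only [outputsFrom, step_fillQueue, Multiset.bind_map, ih, Multiset.filterMap_bind,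
      Multiset.filterMap_filterMap, Assignment.apply_bind_replaceLetters]

/-- The bag of the outputs of the runs from the initial state that use up the queue; initially all
registers of `N` hold the empty word. -/
noncomputable def outputsOn (E : N.Queue S P) (w : List (S ⊕ B)) : Multiset (List (P ⊕ C)) :=
  (N.outputsFrom w (N.q₀, E)).map letters

theorem outputsOn_fillQueue (κ : Assignment P C) (E : N.Queue S P) (w : List (S ⊕ B)) :
    N.outputsOn (N.fillQueue κ E) w = (N.outputsOn E w).filterMap κ.apply := by
  rw [outputsOn, outputsOn, outputsFrom_fillQueue, Multiset.map_filterMap, Multiset.filterMap_map]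
  congr 1
  funext v
  exact map_letters_replaceLetters _ v

theorem outputsOn_map_inr (w : List B) :
    N.outputsOn ([] : N.Queue S P) (w.map .inr) = (N.eval w).map (List.map .inr) := by
  simp only [outputsOn, outputsFrom_map_inr, eval, Multiset.map_map, Function.comp_def,
    letters_map_sumMap]

theorem elim_apply_outputsOn (σ : Assignment S B) (f : List (S ⊕ B)) (E : N.Queue S P) :
    ((σ.apply f).elim 0 fun w => N.outputsOn E w) =
      (N.choices σ (regs f) E).bind fun E' => N.outputsOn E' f := by
  simp only [outputsOn, ← Multiset.map_bind, ← elim_apply_outputsFrom]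
  cases σ.apply f <;> rfl

end NSST

end ET

/-! ### Holes -/

namespace ET

namespace Assignment

variable {R P C : Type*} [Fintype R]

/-- The occurrences of holes on the right-hand sides of an assignment. -/
def holes (α : Assignment R (P ⊕ C)) : Multiset P := α.letters.filterMap Sum.getLeft?

theorem holes_comp_le (α : Assignment R (P ⊕ C)) {β : Assignment R (P ⊕ C)}
    (hβ : β.regs.Nodup) : (comp α β).holes ≤ α.holes + β.holes := by
  rw [holes, holes, holes, ← Multiset.filterMap_add]
  exact Multiset.filterMap_le_filterMap _ (letters_comp_le α hβ)

theorem holes_identity : (identity : Assignment R (P ⊕ C)).holes = 0 := by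
  rw [holes, letters_identity, Multiset.filterMap_zero]

theorem holes_mapLetters_inr (α : Assignment R C) :
    (α.mapLetters (.inr : C → P ⊕ C)).holes = 0 := by
  rw [holes, letters_mapLetters, Multiset.filterMap_map, Multiset.eq_zero_iff_forall_notMem]
  simp

theorem holes_eq_bind (α : Assignment R (P ⊕ C)) :
    α.holes = Finset.univ.val.bind fun X => ET.regs (ET.letters (α.rhs X)) := by
  rw [holes, letters, Multiset.filterMap_bind]
  rfl

end Assignment

namespace NSST

variable {B C S P : Type*} {N : NSST B C}

/-- The effects of all claims are copyless. -/
def Queue.Copyless (E : N.Queue S P) : Prop := ∀ e ∈ E, e.effect.regs.Nodup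

/-- The occurrences of holes in the effects of the claims. -/
def Queue.holes (E : N.Queue S P) : Multiset P :=
  (E : Multiset (N.RunClaim S P)).bind fun e => e.effect.holes

theorem Queue.holes_cons (e : N.RunClaim S P) (E : N.Queue S P) :
    Queue.holes (e :: E) = e.effect.holes + Queue.holes E := by
  rw [Queue.holes, ← Multiset.cons_coe, Multiset.cons_bind, Queue.holes]

variable (N)

theorem copyless_and_holes_le_of_mem_step (x : S ⊕ B) (p : N.Q) (E : N.Queue S P)
    (hE : E.Copyless) :
    ∀ r ∈ N.step x (p, E), r.1.regs.Nodup ∧ r.2.2.Copyless ∧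
      r.1.holes + r.2.2.holes ≤ E.holes := by
  intro r hr
  cases x with
  | inr b =>
    obtain ⟨t, ht, rfl⟩ := Multiset.mem_map.1 hr
    refine ⟨?_, hE, ?_⟩
    · rw [Assignment.regs_mapLetters]
      exact N.copyless p b t ht
    · rw [Assignment.holes_mapLetters_inr, zero_add]
  | inl Y =>
    cases E with
    | nil => simp [step] at hr
    | cons e E =>
      simp only [step] at hr
      split_ifs at hr
      · rw [Multiset.mem_singleton.1 hr]
        exact ⟨hE e List.mem_cons_self, fun e' he' => hE e' (List.mem_cons_of_mem e he'),
          (Queue.holes_cons e E).ge⟩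
      · simp at hr

theorem copyless_and_holes_le_of_mem_runs (w : List (S ⊕ B)) (p : N.Q) (E : N.Queue S P)
    (hE : E.Copyless) :
    ∀ r ∈ N.runs w (p, E), r.1.regs.Nodup ∧ r.2.2.Copyless ∧
      r.1.holes + r.2.2.holes ≤ E.holes := by
  induction w generalizing p E with
  | nil =>
    simp only [runs, Multiset.mem_singleton, forall_eq]
    exact ⟨Assignment.regs_identity (R := N.R) ▸ Finset.univ.nodup, hE,
      by rw [Assignment.holes_identity, zero_add]⟩
  | cons x w ih =>
    simp only [runs, Multiset.mem_bind, Multiset.mem_map]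
    rintro _ ⟨s, hs, r, hr, rfl⟩
    obtain ⟨nodup_s, copyless_s, holes_s⟩ := N.copyless_and_holes_le_of_mem_step x p E hE s hs
    obtain ⟨nodup_r, copyless_r, holes_r⟩ := ih s.2.1 s.2.2 copyless_s r hr
    refine ⟨Multiset.nodup_of_le (Assignment.regs_comp_le _ nodup_r) nodup_s, copyless_r, ?_⟩
    calc (s.1.comp r.1).holes + r.2.2.holes
      _ ≤ s.1.holes + r.1.holes + r.2.2.holes := by
        gcongr
        exact Assignment.holes_comp_le _ nodup_r
      _ = s.1.holes + (r.1.holes + r.2.2.holes) := add_assoc ..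
      _ ≤ s.1.holes + s.2.2.holes := by gcongr
      _ ≤ E.holes := holes_s

theorem copyless_and_holes_le_of_mem_choices (σ : Assignment S B) (ys : List S) (E : N.Queue S P)
    (hE : E.Copyless) :
    ∀ E' ∈ N.choices σ ys E, E'.map Claim.register = ys ∧ E'.Copyless ∧ E'.holes ≤ E.holes := by
  induction ys generalizing E with
  | nil => cases E <;> simp [choices, Queue.Copyless]
  | cons Y ys ih =>
    simp only [choices, Multiset.mem_bind, Multiset.mem_map]
    rintro _ ⟨p, -, r, hr, E', hE', rfl⟩
    cases hY : σ Y with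
    | none => simp [hY] at hr
    | some w =>
      rw [hY] at hr
      obtain ⟨nodup_r, copyless_r, holes_r⟩ := N.copyless_and_holes_le_of_mem_runs w p E hE r hr
      obtain ⟨regs_E', copyless_E', holes_E'⟩ := ih r.2.2 copyless_r E' hE'
      refine ⟨by simp [regs_E'], List.forall_mem_cons.2 ⟨nodup_r, copyless_E'⟩, ?_⟩
      rw [Queue.holes_cons]
      exact (add_le_add_right holes_E' _).trans holes_r

theorem nodup_regs_and_letters_le_of_mem_outputsFrom (w : List (S ⊕ B)) (p : N.Q) (E : N.Queue S P)
    (hE : E.Copyless) :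
    ∀ v ∈ N.outputsFrom w (p, E), (regs v).Nodup ∧
      (regs (letters v) : Multiset P) ≤ E.holes := by
  induction w generalizing p E with
  | nil =>
    cases E with
    | nil =>
      simp only [outputsFrom, Multiset.mem_map]
      rintro _ ⟨f, hf, rfl⟩
      rw [regs_map_sumMap, letters_map_sumMap, regs_map_inr]
      exact ⟨N.final_once p f hf, Multiset.zero_le _⟩
    | cons => simp [outputsFrom]
  | cons x w ih =>
    simp only [outputsFrom, Multiset.mem_bind, Multiset.mem_filterMap]
    rintro v ⟨r, hr, u, hu, huv⟩
    obtain ⟨nodup_r, copyless_r, holes_r⟩ := N.copyless_and_holes_le_of_mem_step x p E hE r hr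
    obtain ⟨nodup_u, holes_u⟩ := ih r.2.1 r.2.2 copyless_r u hu
    refine ⟨Assignment.nodup_regs_of_apply nodup_r nodup_u huv, ?_⟩
    calc (regs (letters v) : Multiset P)
      _ ≤ regs (letters u) + r.1.holes :=
        (Multiset.filterMap_le_filterMap _
          (r.1.letters_le_of_apply nodup_u huv)).trans_eq (Multiset.filterMap_add ..)
      _ ≤ r.1.holes + r.2.2.holes := by
        rw [add_comm]
        gcongr
      _ ≤ E.holes := holes_r

theorem regs_le_holes_of_mem_outputsOn (E : N.Queue S P) (hE : E.Copyless) (w : List (S ⊕ B)) :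
    ∀ v ∈ N.outputsOn E w, (regs v : Multiset P) ≤ E.holes := by
  simp only [outputsOn, Multiset.mem_map]
  rintro _ ⟨v, hv, rfl⟩
  exact (N.nodup_regs_and_letters_le_of_mem_outputsFrom w _ E hE v hv).2

end NSST

end ET

/-! ### Shapes and pieces of assignments -/

namespace ET

theorem subst_flatMap {L M N : Type*} {k : L → Option (List M)} {f : N → List L}
    {g : N → List M} (l : List N) (h : ∀ x ∈ l, subst k (f x) = some (g x)) :
    subst k (l.flatMap f) = some (l.flatMap g) := by
  induction l with
  | nil => rfl
  | cons x l ih =>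
    rw [List.forall_mem_cons] at h
    simp [subst_append, h.1, ih h.2]

theorem flatMap_ite_eq {L M K : Type*} [DecidableEq K] {key : L → K} (g : L → List M) {l : List L}
    (hl : (l.map key).Nodup) {x : L} (hx : x ∈ l) :
    (l.flatMap fun y => if key y = key x then g y else []) = g x := by
  induction l with
  | nil => simp at hx
  | cons y l ih =>
    rw [List.map_cons, List.nodup_cons] at hl
    rw [List.flatMap_cons]
    rcases List.mem_cons.1 hx with rfl | hxl
    · rw [if_pos rfl, List.flatMap_eq_nil_iff.2, List.append_nil]
      exact fun z hz => if_neg fun (hzx : key z = key x) => hl.1 (hzx ▸ List.mem_map_of_mem hz)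
    · rw [ih hl.2 hxl, if_neg, List.nil_append]
      exact fun h => hl.1 (h ▸ List.mem_map_of_mem hxl)

section Pieces

variable {R G : Type*} [DecidableEq R]

/-- The letters before the first register of a word (for `none`) and between the first occurrence
of a register and the next register. -/
def piece : List (R ⊕ G) → Option R → List G
  | [], _ => []
  | .inr g :: w, none => g :: piece w none
  | .inr _ :: w, some Z => piece w (some Z)
  | .inl _ :: _, none => []
  | .inl X :: w, some Z => if Z = X then piece w none else piece w (some Z)

theorem piece_decomposition (w : List (R ⊕ G)) (h : (regs w).Nodup) :
    (piece w none).map .inr ++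
      (regs w).flatMap (fun Z => .inl Z :: (piece w (some Z)).map .inr) = w := by
  induction w with
  | nil => rfl
  | cons x w ih =>
    cases x with
    | inr g =>
      simp only [piece, regs_inr_cons, List.map_cons, List.cons_append]
      rw [ih h]
    | inl X =>
      rw [regs_inl_cons, List.nodup_cons] at h
      simp only [piece, List.map_nil, List.nil_append, regs_inl_cons, List.flatMap_cons, if_true,
        List.cons_append]
      rw [List.flatMap_congr (g := fun Z => .inl Z :: (piece w (some Z)).map .inr), ih h.2]
      intro Z hZ
      rw [if_neg (ne_of_mem_of_not_mem hZ h.1)]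

variable [Fintype R]

theorem sum_piece_le (w : List (R ⊕ G)) :
    ∑ o, (piece w o : Multiset G) ≤ letters w := by
  induction w with
  | nil => simp [piece]
  | cons x w ih =>
    rw [Fintype.sum_option] at ih ⊢
    cases x with
    | inr g =>
      simp only [piece, letters_inr_cons, ← Multiset.cons_coe, Multiset.cons_add]
      exact Multiset.cons_le_cons g ih
    | inl X =>
      refine le_trans ?_ ih
      simp only [piece, Multiset.coe_nil, zero_add]
      calc ∑ Z, ((if Z = X then piece w none else piece w (some Z) : List G) : Multiset G)
        _ ≤ ∑ Z, ((if Z = X then (piece w none : Multiset G) else 0) + piece w (some Z)) :=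
          Finset.sum_le_sum fun Z _ => by
            split_ifs
            exacts [Multiset.le_add_right _ _, (zero_add _).ge]
        _ = piece w none + ∑ Z, (piece w (some Z) : Multiset G) := by
          rw [Finset.sum_add_distrib, Finset.sum_ite_eq' Finset.univ X,
            if_pos (Finset.mem_univ X)]

theorem bind_regs_piece_le {P C : Type*} (w : List (R ⊕ (P ⊕ C))) :
    (Finset.univ.val.bind fun o => (regs (piece w o) : Multiset P)) ≤ regs (letters w) := by
  have h := Multiset.filterMap_le_filterMap Sum.getLeft? (sum_piece_le w)
  rw [Finset.sum_eq_multiset_sum] at h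
  exact (Multiset.filterMap_bind _ _ _).symm.trans_le h

end Pieces

variable {R S G C : Type*}

/-- The word with registers `l` in which all pieces are holes, as the right-hand side for `X` in
the effect of a claim about `Y`. -/
def genericWord (Y : S) (X : R) (l : List R) : List (R ⊕ ((S × R × Option R) ⊕ C)) :=
  .inr (.inl (Y, X, none)) :: l.flatMap fun Z => [.inl Z, .inr (.inl (Y, X, some Z))]

theorem regs_genericWord (Y : S) (X : R) (l : List R) :
    regs (genericWord Y X l : List (R ⊕ ((S × R × Option R) ⊕ C))) = l := by
  induction l with
  | nil => rfl
  | cons Z l ih => simp_all [genericWord]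

theorem regs_letters_genericWord (Y : S) (X : R) (l : List R) :
    regs (letters (genericWord Y X l : List (R ⊕ ((S × R × Option R) ⊕ C)))) =
      (none :: l.map some).map fun o => (Y, X, o) := by
  induction l with
  | nil => rfl
  | cons Z l ih => simp_all [genericWord]

theorem replaceLetters_genericWord [DecidableEq R] {κ : Assignment (S × R × Option R) C} {Y : S}
    {X : R} {w : List (R ⊕ ((S × R × Option R) ⊕ C))} (hw : (regs w).Nodup)
    (hκ : ∀ o, κ (Y, X, o) = some (piece w o)) :
    replaceLetters (NSST.fill κ) (genericWord Y X (regs w)) = some w := by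
  rw [genericWord, replaceLetters, subst, subst_flatMap (g := fun Z =>
    .inl Z :: (piece w (some Z)).map .inr)]
  · simp [NSST.fill, hκ, piece_decomposition w hw]
  · simp [subst, NSST.fill, hκ]

variable [Fintype R]

/-- The orders of registers in the right-hand sides of a copyless assignment. -/
abbrev Shape (R : Type*) [Fintype R] : Type _ :=
  {s : R → Option (List R) // (Finset.univ.val.bind fun X => ((s X).getD [] : Multiset R)).Nodup}

theorem Shape.nodup_getD (s : Shape R) (X : R) : ((s.1 X).getD []).Nodup :=
  Multiset.nodup_of_le
    (Multiset.le_bind (f := fun X => ((s.1 X).getD [] : Multiset R)) _ (Finset.mem_univ X)) s.2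

instance : Finite (Shape R) := by
  classical
  refine Finite.of_injective (β := R → Bool × {l : List R // l.Nodup})
    (fun s X => ((s.1 X).isSome, ⟨(s.1 X).getD [], s.nodup_getD X⟩)) fun s s' h => Subtype.ext ?_
  funext X
  have hX := congrFun h X
  simp only [Prod.mk.injEq, Subtype.mk.injEq] at hX
  cases h1 : s.1 X <;> cases h2 : s'.1 X <;> simp_all

theorem Assignment.bind_getD_map_regs (α : Assignment R G) :
    (Finset.univ.val.bind fun X => (((α X).map ET.regs).getD [] : Multiset R)) = α.regs := by
  refine Multiset.bind_congr fun X _ => ?_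
  cases h : α X <;> simp [rhs, h]

open Classical in
/-- The shape of a copyless assignment, with a junk value for other assignments. -/
noncomputable def Assignment.shape (α : Assignment R G) : Shape R :=
  if h : α.regs.Nodup then ⟨fun X => (α X).map ET.regs, α.bind_getD_map_regs.symm ▸ h⟩
  else ⟨fun _ => none, by simp⟩

theorem Assignment.shape_val {α : Assignment R G} (h : α.regs.Nodup) :
    α.shape.1 = fun X => (α X).map ET.regs := by
  rw [shape, dif_pos h]

/-- The assignment of a given shape in which all pieces are holes. -/
def genericAssignment (Y : S) (s : Shape R) : Assignment R ((S × R × Option R) ⊕ C) :=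
  fun X => (s.1 X).map (genericWord Y X)

theorem nodup_regs_genericAssignment (Y : S) (s : Shape R) :
    (genericAssignment Y s : Assignment R ((S × R × Option R) ⊕ C)).regs.Nodup := by
  refine Multiset.nodup_of_le (le_of_eq (Multiset.bind_congr fun X _ => ?_)) s.2
  cases h : s.1 X <;> simp [Assignment.rhs, genericAssignment, h, regs_genericWord]

theorem holes_genericAssignment_le (Y : S) (s : Shape R) :
    (genericAssignment Y s : Assignment R ((S × R × Option R) ⊕ C)).holes ≤
      Finset.univ.val.map (Y, ·) := by
  have holes_rhs (X : R) :
      (regs (letters ((genericAssignment Y s : Assignment R (_ ⊕ C)).rhs X)) : Multiset _) ≤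
        Finset.univ.val.map fun o : Option R => (Y, X, o) := by
    cases h : s.1 X with
    | none => simp [Assignment.rhs, genericAssignment, h]
    | some l =>
      have hl : (l : Multiset R) ≤ Finset.univ.val :=
        (Multiset.le_iff_subset (Multiset.coe_nodup.2 (by simpa [h] using s.nodup_getD X))).2
          fun Z _ => Finset.mem_univ Z
      rw [Assignment.rhs, genericAssignment, h, Option.map_some, Option.getD_some,
        regs_letters_genericWord, ← Multiset.map_coe, ← Multiset.cons_coe, ← Multiset.map_coe]
      exact Multiset.map_le_map (Multiset.cons_le_cons none (Multiset.map_le_map hl))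
  rw [Assignment.holes_eq_bind]
  calc _ ≤ Finset.univ.val.bind fun X : R => Finset.univ.val.map fun o : Option R => (Y, X, o) :=
        bind_le_bind fun X _ => holes_rhs X
    _ = Finset.univ.val.map (Y, ·) := by
      change _ = (Finset.univ.val.bind fun X : R =>
        Finset.univ.val.map (Prod.mk X : Option R → R × Option R)).map (Y, ·)
      simp only [Multiset.map_bind, Multiset.map_map, Function.comp_def]

namespace NSST

variable {B : Type*} {N : NSST B C} [DecidableEq S]

variable (N) in
/-- The registers that hold the pieces of the effects in a queue of claims about `S`. -/
abbrev PieceReg (S : Type*) : Type _ := S × N.R × Option N.R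

/-- The assignment that stores the pieces of the effects in a queue. -/
def pieceAssignment (E : N.Queue S (N.PieceReg S)) : Assignment (N.PieceReg S) C := fun r =>
  some (E.flatMap fun e =>
    if e.register = r.1 then piece (e.effect.rhs r.2.1) r.2.2 else [])

variable (N) in
/-- Finite descriptions of queues of claims. -/
abbrev QueueShape (S : Type*) : Type _ :=
  {g : List (Claim S N.Q (Shape N.R)) // (g.map Claim.register).Nodup}

omit [DecidableEq S] in
instance [Finite S] : Finite (N.QueueShape S) := by
  have := Fintype.ofFinite S
  refine Set.Finite.subset
    (List.finite_length_le (Claim S N.Q (Shape N.R)) (Fintype.card S)) fun g hg => ?_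
  simpa using List.Nodup.length_le_card hg

/-- The shape of a queue of claims about distinct registers, with a junk value for other queues. -/
noncomputable def Queue.shape {P : Type*} (E : N.Queue S P) : N.QueueShape S :=
  if h : (E.map Claim.register).Nodup then
    ⟨E.map (Claim.map Assignment.shape), by simpa [Function.comp_def, Claim.map] using h⟩
  else ⟨[], by simp⟩

/-- The queue of claims of a given shape in which all pieces are holes. -/
def genericQueue (g : N.QueueShape S) : N.Queue S (N.PieceReg S) :=
  g.1.map fun e => e.map (genericAssignment e.register)

omit [DecidableEq S] in
theorem copyless_genericQueue (g : N.QueueShape S) : (genericQueue g).Copyless := by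
  rintro _ he
  obtain ⟨e, _, rfl⟩ := List.mem_map.1 he
  exact nodup_regs_genericAssignment _ _

omit [DecidableEq S] in
theorem nodup_holes_genericQueue [Finite S] (g : N.QueueShape S) :
    (genericQueue g).holes.Nodup := by
  have := Fintype.ofFinite S
  refine Multiset.nodup_of_le ?_ (Finset.univ (α := N.PieceReg S)).nodup
  calc (genericQueue g).holes
    _ ≤ (g.1 : Multiset (Claim S N.Q (Shape N.R))).bind fun e =>
          Finset.univ.val.map (e.register, ·) := by
      rw [Queue.holes, genericQueue, ← Multiset.map_coe, Multiset.bind_map]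
      exact bind_le_bind fun e _ => holes_genericAssignment_le _ _
    _ = (g.1.map Claim.register : Multiset S).bind fun Y => Finset.univ.val.map (Y, ·) := by
      rw [← Multiset.map_coe, Multiset.bind_map]
    _ ≤ Finset.univ.val.bind fun Y => Finset.univ.val.map (Y, ·) :=
      bind_le_bind_univ (Multiset.coe_nodup.2 g.2) _
    _ = Finset.univ.val := rfl

theorem pieceAssignment_apply {E : N.Queue S (N.PieceReg S)}
    (h : (E.map Claim.register).Nodup) {e : N.RunClaim S (N.PieceReg S)} (he : e ∈ E) (X : N.R)
    (o : Option N.R) :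
    pieceAssignment E (e.register, X, o) = some (piece (e.effect.rhs X) o) :=
  congrArg some (flatMap_ite_eq (fun e => piece (e.effect.rhs X) o) h he)

theorem fillQueue_genericQueue_shape (E : N.Queue S (N.PieceReg S))
    (h : (E.map Claim.register).Nodup) (hc : E.Copyless) :
    N.fillQueue (pieceAssignment E) (genericQueue E.shape) = E := by
  rw [Queue.shape, dif_pos h, fillQueue, genericQueue, List.map_map, List.map_map]
  refine (List.map_congr_left fun e he => ?_).trans (List.map_id E)
  suffices (genericAssignment e.register e.effect.shape).substLetters
      (fill (pieceAssignment E)) = e.effect by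
    simp [Claim.map, this]
  funext X
  rw [Assignment.substLetters, genericAssignment, Assignment.shape_val (hc e he)]
  cases hX : e.effect X with
  | none => simp only [hX, Option.map_none, Option.bind_none]
  | some w =>
    simp only [hX, Option.map_some, Option.bind_some]
    have hw : e.effect.rhs X = w := by rw [Assignment.rhs, hX, Option.getD_some]
    refine replaceLetters_genericWord ?_ fun o => ?_
    · exact Multiset.coe_nodup.1 (Multiset.nodup_of_le (hw ▸ e.effect.coe_regs_rhs_le X) (hc e he))
    · rw [pieceAssignment_apply h he, hw]

theorem regs_pieceAssignment_le [Fintype S] (E : N.Queue S (N.PieceReg S)) :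
    (pieceAssignment E).regs ≤ E.holes :=
  calc (pieceAssignment E).regs
    _ = Finset.univ.val.bind fun r : N.PieceReg S =>
          (E : Multiset (N.RunClaim S (N.PieceReg S))).bind fun e =>
            if e.register = r.1 then
              (regs (piece (e.effect.rhs r.2.1) r.2.2) : Multiset (N.PieceReg S)) else 0 := by
      refine Multiset.bind_congr fun r _ => ?_
      rw [Assignment.rhs, pieceAssignment, Option.getD_some, regs, List.filterMap_flatMap,
        ← Multiset.coe_bind]
      exact Multiset.bind_congr fun e _ => by split_ifs <;> rfl
    _ = (E : Multiset (N.RunClaim S (N.PieceReg S))).bind fun e =>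
          Finset.univ.val.bind fun X => Finset.univ.val.bind fun o =>
            (regs (piece (e.effect.rhs X) o) : Multiset (N.PieceReg S)) := by
      rw [Multiset.bind_bind]
      refine Multiset.bind_congr fun e _ => ?_
      change ∑ r : S × N.R × Option N.R, _ = ∑ X, ∑ o, _
      rw [Fintype.sum_prod_type, Fintype.sum_eq_single e.register fun Y hY => ?_]
      · simp [Fintype.sum_prod_type]
      · simp [hY.symm]
    _ ≤ (E : Multiset (N.RunClaim S (N.PieceReg S))).bind fun e =>
          Finset.univ.val.bind fun X => regs (letters (e.effect.rhs X)) :=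
      bind_le_bind fun e _ => bind_le_bind fun X _ => bind_regs_piece_le (e.effect.rhs X)
    _ = E.holes := Multiset.bind_congr fun (e : N.RunClaim S (N.PieceReg S)) _ =>
      e.effect.holes_eq_bind.symm

end NSST

end ET

/-! ### Composition of nondeterministic streaming string transducers -/

namespace ET.NSST

section Init

variable {A B : Type*} (N : NSST A B) (I : Multiset (Assignment N.R B × N.Q))
  (hI : ∀ p ∈ I, p.1.regs.Nodup)

/-- The transducer that starts in any of the given states, after any of the given assignments. -/
abbrev withInit : NSST A B where
  Q := Option N.Q
  R := N.R
  δ q a := q.elim (I.bind fun p => (N.δ p.2 a).map fun r => (p.1.comp r.1, some r.2))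
    fun q => (N.δ q a).map fun r => (r.1, some r.2)
  copyless q a := by
    cases q with
    | none =>
      simp only [Option.elim_none, Multiset.mem_bind, Multiset.mem_map]
      rintro _ ⟨p, hp, r, hr, rfl⟩
      exact Multiset.nodup_of_le (Assignment.regs_comp_le _ (N.copyless _ _ r hr)) (hI p hp)
    | some q =>
      simp only [Option.elim_some, Multiset.mem_map]
      rintro _ ⟨r, hr, rfl⟩
      exact N.copyless _ _ r hr
  q₀ := none
  F q := q.elim (I.bind fun p => (N.F p.2).filterMap p.1.apply) N.F
  final_once q := by
    cases q with
    | none =>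
      simp only [Option.elim_none, Multiset.mem_bind, Multiset.mem_filterMap]
      rintro v ⟨p, hp, w, hw, hv⟩
      exact Assignment.nodup_regs_of_apply (hI p hp) (N.final_once _ w hw) hv
    | some q => exact N.final_once q

theorem symbolicOutputs_withInit_some (w : List A) (q : N.Q) :
    (N.withInit I hI).symbolicOutputs w (some q) = N.symbolicOutputs w q := by
  induction w generalizing q with
  | nil => rfl
  | cons a w ih => simp only [symbolicOutputs, Option.elim_some, Multiset.bind_map, ih]

theorem symbolicOutputs_withInit_none (w : List A) :
    (N.withInit I hI).symbolicOutputs w none =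
      I.bind fun p => (N.symbolicOutputs w p.2).filterMap p.1.apply := by
  cases w with
  | nil => rfl
  | cons a w =>
    simp only [symbolicOutputs, Option.elim_none, Multiset.bind_assoc, Multiset.bind_map,
      symbolicOutputs_withInit_some, Multiset.filterMap_bind, Multiset.filterMap_filterMap,
      ← Assignment.apply_comp]

end Init

section Composition

variable {A B C : Type*} (N₁ : NSST A B) (N₂ : NSST B C)

/-- The configurations after a transition of the first transducer with assignment `σ` and target
`q`, for a given queue of claims about its register contents before the transition. -/
noncomputable def successors (σ : Assignment N₁.R B) (q : N₁.Q)
    (E : N₂.Queue N₁.R (N₂.PieceReg N₁.R)) :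
    Multiset (Assignment (N₂.PieceReg N₁.R) C × N₁.Q × N₂.QueueShape N₁.R) :=
  (Finset.univ.val (α := {l : List N₁.R // l.Nodup})).bind fun ys =>
    (N₂.choices σ ys.1 E).map fun E' => (pieceAssignment E', q, E'.shape)

theorem nodup_regs_of_mem_successors (σ : Assignment N₁.R B) (q : N₁.Q)
    (E : N₂.Queue N₁.R (N₂.PieceReg N₁.R)) (hE : E.Copyless) (nodup_holes : E.holes.Nodup) :
    ∀ p ∈ N₁.successors N₂ σ q E, p.1.regs.Nodup := by
  simp only [successors, Multiset.mem_bind, Multiset.mem_map]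
  rintro _ ⟨ys, -, E', hE', rfl⟩
  obtain ⟨-, -, holes_E'⟩ := N₂.copyless_and_holes_le_of_mem_choices σ ys.1 E hE E' hE'
  exact Multiset.nodup_of_le ((regs_pieceAssignment_le E').trans holes_E') nodup_holes

/-- The transducer that guesses runs of `N₂` on the register contents of `N₁`. -/
noncomputable abbrev guess : NSST A C where
  Q := N₁.Q × N₂.QueueShape N₁.R
  R := N₂.PieceReg N₁.R
  finQ := Fintype.ofFinite _
  δ s a := (N₁.δ s.1 a).bind fun p => N₁.successors N₂ p.1 p.2 (genericQueue s.2)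
  copyless s a := by
    simp only [Multiset.mem_bind]
    rintro p ⟨r, -, hp⟩
    exact N₁.nodup_regs_of_mem_successors N₂ _ _ _ (copyless_genericQueue _)
      (nodup_holes_genericQueue _) p hp
  q₀ := (N₁.q₀, ⟨[], List.nodup_nil⟩)
  F s := (N₁.F s.1).bind fun f => N₂.outputsOn (genericQueue s.2) f
  final_once s := by
    simp only [Multiset.mem_bind]
    rintro v ⟨f, -, hv⟩
    exact Multiset.coe_nodup.1 <| Multiset.nodup_of_le
      (N₂.regs_le_holes_of_mem_outputsOn _ (copyless_genericQueue _) f v hv)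
      (nodup_holes_genericQueue _)

theorem bind_choices_outputsOn (σ : Assignment N₁.R B) {P : Type*} (E : N₂.Queue N₁.R P)
    (hE : E.Copyless) {f : List (N₁.R ⊕ B)} (hf : (regs f).Nodup) :
    ((Finset.univ.val (α := {l : List N₁.R // l.Nodup})).bind fun ys =>
        (N₂.choices σ ys.1 E).bind fun E' => N₂.outputsOn E' f) =
      (σ.apply f).elim 0 fun w => N₂.outputsOn E w := by
  rw [bind_univ_eq_of_unique ⟨regs f, hf⟩, N₂.elim_apply_outputsOn]
  intro ys hys
  refine (Multiset.bind_congr (g := fun _ => 0) fun E' hE' => ?_).trans (Multiset.bind_zero _)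
  rw [outputsOn, N₂.outputsFrom_eq_zero, Multiset.map_zero]
  rw [(N₂.copyless_and_holes_le_of_mem_choices σ ys.1 E hE E' hE').1]
  exact fun h => hys (Subtype.ext h)

theorem bind_successors (w : List A) (q : N₁.Q)
    (h : ∀ g, (N₁.guess N₂).symbolicOutputs w (q, g) =
      (N₁.symbolicOutputs w q).bind fun f => N₂.outputsOn (genericQueue g) f)
    (σ : Assignment N₁.R B) (E : N₂.Queue N₁.R (N₂.PieceReg N₁.R)) (hE : E.Copyless) :
    ((N₁.successors N₂ σ q E).bind fun p =>
        ((N₁.guess N₂).symbolicOutputs w p.2).filterMap p.1.apply) =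
      ((N₁.symbolicOutputs w q).filterMap σ.apply).bind fun f => N₂.outputsOn E f := by
  have outputs_of_choice (ys : {l : List N₁.R // l.Nodup}) :
      ∀ E' ∈ N₂.choices σ ys.1 E,
        ((N₁.guess N₂).symbolicOutputs w (q, E'.shape)).filterMap (pieceAssignment E').apply =
          (N₁.symbolicOutputs w q).bind fun f => N₂.outputsOn E' f := by
    intro E' hE'
    obtain ⟨regs_E', copyless_E', -⟩ :=
      N₂.copyless_and_holes_le_of_mem_choices σ ys.1 E hE E' hE'
    rw [h, Multiset.filterMap_bind]
    refine Multiset.bind_congr fun f _ => ?_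
    rw [← N₂.outputsOn_fillQueue,
      fillQueue_genericQueue_shape E' (regs_E'.symm ▸ ys.2) copyless_E']
  simp only [successors, Multiset.bind_assoc, Multiset.bind_map]
  rw [Multiset.bind_congr fun ys _ => Multiset.bind_congr (outputs_of_choice ys),
    Multiset.bind_congr fun ys _ => Multiset.bind_bind _ _, Multiset.bind_bind,
    Multiset.bind_filterMap]
  refine Multiset.bind_congr fun f hf => ?_
  rw [N₁.bind_choices_outputsOn N₂ σ E hE (N₁.nodup_regs_of_mem_symbolicOutputs w q f hf)]
  cases σ.apply f <;> rfl

theorem symbolicOutputs_guess (w : List A) (q : N₁.Q) (g : N₂.QueueShape N₁.R) :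
    (N₁.guess N₂).symbolicOutputs w (q, g) =
      (N₁.symbolicOutputs w q).bind fun f => N₂.outputsOn (genericQueue g) f := by
  induction w generalizing q g with
  | nil => rfl
  | cons a w ih =>
    simp only [symbolicOutputs, Multiset.bind_assoc]
    exact Multiset.bind_congr fun p _ =>
      N₁.bind_successors N₂ w p.2 (ih p.2) p.1 _ (copyless_genericQueue g)

theorem exists_comp : ∃ N : NSST A C, ∀ w, N.eval w = (N₁.eval w).bind N₂.eval := by
  have copyless_nil : Queue.Copyless ([] : N₂.Queue N₁.R (N₂.PieceReg N₁.R)) := by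
    simp [Queue.Copyless]
  have nodup_holes_nil : (Queue.holes ([] : N₂.Queue N₁.R (N₂.PieceReg N₁.R))).Nodup := by
    simp [Queue.holes]
  refine ⟨(N₁.guess N₂).withInit (N₁.successors N₂ (fun _ => some []) N₁.q₀ [])
    (N₁.nodup_regs_of_mem_successors N₂ _ _ _ copyless_nil nodup_holes_nil), fun w => ?_⟩
  rw [eval, symbolicOutputs_withInit_none,
    N₁.bind_successors N₂ w N₁.q₀ (N₁.symbolicOutputs_guess N₂ w N₁.q₀) _ _ copyless_nil,
    Multiset.map_bind, Multiset.bind_filterMap, eval, Multiset.bind_map]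
  refine Multiset.bind_congr fun f _ => ?_
  rw [Assignment.apply_const_nil, Option.map_some, Option.getD_some,
    outputsOn_map_inr, Multiset.map_map]
  simp only [Function.comp_def, letters_map_inr, Multiset.map_id']

end Composition

end ET.NSST

/-! ### Spans of multiref-words -/

namespace ET

theorem doc_append {A X : Type*} (u v : List (RefSym A X)) : doc (u ++ v) = doc u ++ doc v := by
  induction u with
  | nil => rfl
  | cons c u ih => cases c <;> simp [doc, ih]

theorem length_doc_cons {A X : Type*} (c : RefSym A X) (w : List (RefSym A X)) :
    (doc (c :: w)).length = (doc [c]).length + (doc w).length := by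
  rw [← List.singleton_append, doc_append, List.length_append]

variable {A X : Type*} [DecidableEq X]

/-- The position of the next bracket of `x` in a word if it is a closing one. -/
def nextCls (x : X) : List (RefSym A X) → Option ℕ
  | [] => none
  | .letter _ :: w => (nextCls x w).map (· + 1)
  | .opn y :: w => if y = x then none else nextCls x w
  | .cls y :: w => if y = x then some 0 else nextCls x w

/-- The spans of `x` in a word in increasing order; a recursive version of `HasSpan`. -/
def spans (x : X) : List (RefSym A X) → List (ℕ × ℕ)
  | [] => []
  | .letter _ :: w => (spans x w).map fun s => (s.1 + 1, s.2 + 1)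
  | .opn y :: w => if y = x then (nextCls x w).toList.map (Prod.mk 0) ++ spans x w else spans x w
  | .cls _ :: w => spans x w

theorem exists_eq_append_of_nextCls {x : X} {w : List (RefSym A X)} {j : ℕ}
    (h : nextCls x w = some j) :
    ∃ v z, w = v ++ RefSym.cls x :: z ∧ RefSym.opn x ∉ v ∧ RefSym.cls x ∉ v ∧
      j = (doc v).length := by
  induction w generalizing j with
  | nil => cases h
  | cons c w ih =>
    cases c with
    | letter a =>
      obtain ⟨j, hj, rfl⟩ := Option.map_eq_some_iff.1 h
      obtain ⟨v, z, rfl, ho, hc, rfl⟩ := ih hj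
      exact ⟨.letter a :: v, z, rfl, by simpa using ho, by simpa using hc, rfl⟩
    | opn y =>
      obtain ⟨hy, h⟩ : y ≠ x ∧ nextCls x w = some j := by simpa [nextCls] using h
      obtain ⟨v, z, rfl, ho, hc, rfl⟩ := ih h
      exact ⟨.opn y :: v, z, rfl, by simpa using ⟨hy.symm, ho⟩, by simpa using hc, rfl⟩
    | cls y =>
      by_cases hy : y = x
      · subst hy
        exact ⟨[], w, rfl, by simp, by simp, by simpa [nextCls, doc, eq_comm] using h⟩
      · rw [nextCls, if_neg hy] at h
        obtain ⟨v, z, rfl, ho, hc, rfl⟩ := ih h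
        exact ⟨.cls y :: v, z, rfl, by simpa using ho, by simpa using ⟨Ne.symm hy, hc⟩, rfl⟩

theorem nextCls_append_cls {x : X} {v : List (RefSym A X)} (ho : RefSym.opn x ∉ v)
    (hc : RefSym.cls x ∉ v) (z : List (RefSym A X)) :
    nextCls x (v ++ RefSym.cls x :: z) = some (doc v).length := by
  induction v with
  | nil => exact if_pos rfl
  | cons c v ih =>
    rw [List.mem_cons, not_or] at ho hc
    specialize ih ho.2 hc.2
    cases c with
    | letter a => exact congrArg (Option.map (· + 1)) ih
    | opn y => exact (if_neg fun h : y = x => ho.1 (h ▸ rfl)).trans ih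
    | cls y => exact (if_neg fun h : y = x => hc.1 (h ▸ rfl)).trans ih

theorem hasSpan_cons (x : X) (c : RefSym A X) (w : List (RefSym A X)) (i j : ℕ) :
    HasSpan (c :: w) x i j ↔ (c = .opn x ∧ i = 0 ∧ nextCls x w = some j) ∨
      ∃ i' j', HasSpan w x i' j' ∧ i = (doc [c]).length + i' ∧ j = (doc [c]).length + j' := by
  constructor
  · rintro ⟨u, v, z, h, ho, hc, rfl, rfl⟩
    cases u with
    | nil =>
      simp only [List.nil_append, List.cons_append, List.cons.injEq, List.append_assoc] at h
      obtain ⟨rfl, rfl⟩ := h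
      exact .inl ⟨rfl, rfl, by simpa [doc] using nextCls_append_cls ho hc z⟩
    | cons c' u =>
      simp only [List.cons_append, List.cons.injEq] at h
      obtain ⟨rfl, rfl⟩ := h
      exact .inr ⟨_, _, ⟨u, v, z, rfl, ho, hc, rfl, rfl⟩, length_doc_cons c u,
        by rw [length_doc_cons c u, add_assoc]⟩
  · rintro (⟨rfl, rfl, h⟩ | ⟨_, _, ⟨u, v, z, rfl, ho, hc, rfl, rfl⟩, rfl, rfl⟩)
    · obtain ⟨v, z, rfl, ho, hc, rfl⟩ := exists_eq_append_of_nextCls h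
      exact ⟨[], v, z, by simp, ho, hc, rfl, by simp [doc]⟩
    · exact ⟨c :: u, v, z, rfl, ho, hc, (length_doc_cons c u).symm,
        by rw [length_doc_cons c u, add_assoc]⟩

theorem hasSpan_iff_mem_spans (x : X) (w : List (RefSym A X)) (i j : ℕ) :
    HasSpan w x i j ↔ (i, j) ∈ spans x w := by
  induction w generalizing i j with
  | nil => simp [HasSpan, spans]
  | cons c w ih =>
    simp only [hasSpan_cons, ih]
    cases c with
    | letter a => simp [spans, doc, add_comm 1, eq_comm]
    | opn y =>
      by_cases hy : y = x <;> simp [doc, spans, hy, eq_comm (a := i), and_comm]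
    | cls y => simp [doc, spans]

theorem nextCls_le {x : X} {w : List (RefSym A X)} {j : ℕ} (h : nextCls x w = some j) :
    j ≤ (doc w).length := by
  obtain ⟨v, z, rfl, -, -, rfl⟩ := exists_eq_append_of_nextCls h
  rw [doc_append, List.length_append]
  exact Nat.le_add_right _ _

theorem le_of_mem_spans {x : X} {w : List (RefSym A X)} :
    ∀ s ∈ spans x w, s.1 ≤ s.2 ∧ s.2 ≤ (doc w).length := by
  induction w with
  | nil => simp [spans]
  | cons c w ih =>
    cases c with
    | letter a =>
      exact List.forall_mem_map.2 fun s hs =>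
        ⟨Nat.succ_le_succ (ih s hs).1, Nat.succ_le_succ (ih s hs).2⟩
    | opn y =>
      by_cases hy : y = x
      · rw [spans, if_pos hy, List.forall_mem_append, List.forall_mem_map]
        exact ⟨fun j hj => ⟨Nat.zero_le j, nextCls_le (w := w) (Option.mem_toList.1 hj)⟩, ih⟩
      · rw [spans, if_neg hy]
        exact ih
    | cls y => exact ih

theorem nextCls_le_of_mem_spans {x : X} {w : List (RefSym A X)} {j : ℕ} {s : ℕ × ℕ}
    (hj : nextCls x w = some j) (hs : s ∈ spans x w) : j ≤ s.1 := by
  induction w generalizing j s with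
  | nil => cases hj
  | cons c w ih =>
    cases c with
    | letter a =>
      obtain ⟨j', hj', rfl⟩ := Option.map_eq_some_iff.1 hj
      obtain ⟨s', hs', rfl⟩ := List.mem_map.1 hs
      exact Nat.succ_le_succ (ih hj' hs')
    | opn y =>
      obtain ⟨hy, hj⟩ : y ≠ x ∧ nextCls x w = some j := by simpa [nextCls] using hj
      rw [spans, if_neg hy] at hs
      exact ih hj hs
    | cls y =>
      by_cases hy : y = x
      · rw [nextCls, if_pos hy] at hj
        cases hj
        exact Nat.zero_le _
      · rw [nextCls, if_neg hy] at hj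
        exact ih hj hs

theorem pairwise_spans (x : X) (w : List (RefSym A X)) :
    (spans x w).Pairwise fun s s' => s.2 ≤ s'.1 := by
  induction w with
  | nil => exact .nil
  | cons c w ih =>
    cases c with
    | letter a => exact List.pairwise_map.2 (ih.imp Nat.succ_le_succ)
    | opn y =>
      by_cases hy : y = x
      · rw [spans, if_pos hy]
        cases hj : nextCls x w with
        | none => exact ih
        | some j => exact List.pairwise_cons.2 ⟨fun s hs => nextCls_le_of_mem_spans hj hs, ih⟩
      · rwa [spans, if_neg hy]
    | cls y => exact ih

theorem disjoint_of_mem_spans {x : X} {w : List (RefSym A X)} {s s' : ℕ × ℕ}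
    (hs : s ∈ spans x w) (hs' : s' ∈ spans x w) (hne : s ≠ s') : s.2 ≤ s'.1 ∨ s'.2 ≤ s.1 := by
  let R (s s' : ℕ × ℕ) : Prop := s.2 ≤ s'.1 ∨ s'.2 ≤ s.1
  have : Std.Symm R := ⟨fun _ _ => Or.symm⟩
  have hR : (spans x w).Pairwise R := (pairwise_spans x w).imp Or.inl
  exact hR.forall hs hs' hne

/-! ### Alternating brackets -/

/-- The brackets of `x` alternate, the first one being closing iff `b` holds, and the last one is
closing. -/
def Alternating (x : X) : Bool → List (RefSym A X) → Prop
  | b, [] => b = false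
  | b, .letter _ :: w => Alternating x b w
  | b, .opn y :: w => if y = x then b = false ∧ Alternating x true w else Alternating x b w
  | b, .cls y :: w => if y = x then b = true ∧ Alternating x false w else Alternating x b w

theorem Alternating.isSome_nextCls {x : X} {b : Bool} {w : List (RefSym A X)}
    (h : Alternating x b w) : (nextCls x w).isSome = b := by
  induction w with
  | nil => cases h; rfl
  | cons c w ih =>
    cases c with
    | letter a => simpa [nextCls] using ih h
    | opn y => by_cases hy : y = x <;> simp_all [Alternating, nextCls]
    | cls y => by_cases hy : y = x <;> simp_all [Alternating, nextCls]

theorem Alternating.append {x : X} {b : Bool} {u v : List (RefSym A X)} (hu : Alternating x b u)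
    (hv : Alternating x false v) : Alternating x b (u ++ v) := by
  induction u generalizing b with
  | nil => cases hu; exact hv
  | cons c u ih =>
    cases c with
    | letter a => exact ih hu
    | opn y =>
      by_cases hy : y = x
      · simp only [Alternating, if_pos hy, List.cons_append] at hu ⊢
        exact hu.imp_right ih
      · simp only [Alternating, if_neg hy, List.cons_append] at hu ⊢
        exact ih hu
    | cls y =>
      by_cases hy : y = x
      · simp only [Alternating, if_pos hy, List.cons_append] at hu ⊢
        exact hu.imp_right ih
      · simp only [Alternating, if_neg hy, List.cons_append] at hu ⊢
        exact ih hu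

theorem alternating_append_of_notMem {x : X} {b : Bool} {u v : List (RefSym A X)}
    (ho : RefSym.opn x ∉ u) (hc : RefSym.cls x ∉ u) (hv : Alternating x b v) :
    Alternating x b (u ++ v) := by
  induction u with
  | nil => exact hv
  | cons c u ih =>
    rw [List.mem_cons, not_or] at ho hc
    specialize ih ho.2 hc.2
    cases c with
    | letter a => exact ih
    | opn y => rwa [List.cons_append, Alternating, if_neg fun h : y = x => ho.1 (h ▸ rfl)]
    | cls y => rwa [List.cons_append, Alternating, if_neg fun h : y = x => hc.1 (h ▸ rfl)]

end ET

namespace ET.Expr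

variable {A X : Type*}

theorem notMem_of_not_mentions {x : X} {R : Expr A X} (h : ¬ R.Mentions x)
    {w : List (RefSym A X)} (hw : w ∈ R.lang) : RefSym.opn x ∉ w ∧ RefSym.cls x ∉ w := by
  induction R generalizing w with
  | eps => cases hw; simp
  | sym a => cases hw; simp
  | cat R R' ih ih' =>
    simp only [Mentions, not_or] at h
    obtain ⟨u, hu, v, hv, rfl⟩ := hw
    simpa [not_or] using ⟨⟨(ih h.1 hu).1, (ih' h.2 hv).1⟩, (ih h.1 hu).2, (ih' h.2 hv).2⟩
  | alt R R' ih ih' =>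
    simp only [Mentions, not_or] at h
    rcases hw with hw | hw
    · exact ih h.1 hw
    · exact ih' h.2 hw
  | star R ih =>
    obtain ⟨l, rfl, hl⟩ := hw
    simp only [List.mem_flatten, not_exists, not_and]
    exact ⟨fun w hw => (ih h (hl w hw)).1, fun w hw => (ih h (hl w hw)).2⟩
  | bind y R ih =>
    simp only [Mentions, not_or] at h
    obtain ⟨_, ⟨_, rfl, v, hv, rfl⟩, _, rfl, rfl⟩ := hw
    simpa [h.1] using ih h.2 hv

theorem WellFormed.alternating [DecidableEq X] {R : Expr A X} (h : R.WellFormed)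
    {w : List (RefSym A X)} (hw : w ∈ R.lang) (x : X) : Alternating x false w := by
  induction R generalizing w with
  | eps => cases hw; rfl
  | sym a => cases hw; rfl
  | cat R R' ih ih' =>
    obtain ⟨u, hu, v, hv, rfl⟩ := hw
    exact (ih h.1 hu).append (ih' h.2 hv)
  | alt R R' ih ih' =>
    rcases hw with hw | hw
    · exact ih h.1 hw
    · exact ih' h.2 hw
  | star R ih =>
    obtain ⟨l, rfl, hl⟩ := hw
    induction l with
    | nil => rfl
    | cons w l ihl =>
      rw [List.flatten_cons]
      exact (ih h (hl w (by simp))).append (ihl fun y hy => hl y (by simp [hy]))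
  | bind y R ih =>
    obtain ⟨_, ⟨_, rfl, v, hv, rfl⟩, _, rfl, rfl⟩ := hw
    by_cases hy : y = x
    · subst hy
      obtain ⟨h1, h2⟩ := notMem_of_not_mentions h.1 hv
      simp only [List.cons_append, Alternating, if_true, true_and]
      exact alternating_append_of_notMem h1 h2 (by simp [Alternating])
    · simp only [List.cons_append, Alternating, if_neg hy]
      exact (ih h.2 hv).append (by simp [Alternating, hy])

end ET.Expr

/-! ### Labels of gaps -/

namespace ET

variable {A X : Type*}

/-- The numbers `c`, `e` and `o` of all variables in a gap. -/
abbrev Label (X : Type*) : Type _ := X → Bool × Bool × Bool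

section Labels

variable [DecidableEq X]

/-- The labels of the gaps of the document described by a word. -/
def labels : List (RefSym A X) → List (Label X)
  | [] => [fun _ => (false, false, false)]
  | .letter _ :: w => (fun _ => (false, false, false)) :: labels w
  | .opn x :: w => (labels w).modifyHead fun z => Function.update z x
      (if (z x).1 then (false, true, (z x).2.2) else (false, (z x).2.1, true))
  | .cls x :: w => (labels w).modifyHead fun z => Function.update z x (true, (z x).2)

theorem length_labels (w : List (RefSym A X)) : (labels w).length = (doc w).length + 1 := by
  induction w with
  | nil => rfl
  | cons c w ih => cases c <;> simp [labels, doc, ih]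

/-- `p` is the label of the gap `i` for the variable `x` when `w` is read from right to left: it
also accounts for a closing bracket of `x` at `i` whose partner is not in `w`. -/
structure RecordsSpans (x : X) (w : List (RefSym A X)) (i : ℕ) (p : Bool × Bool × Bool) :
    Prop where
  closes : p.1 = true ↔ (∃ j, j ≠ i ∧ (j, i) ∈ spans x w) ∨ nextCls x w = some i
  empty : p.2.1 = true ↔ (i, i) ∈ spans x w
  opens : p.2.2 = true ↔ ∃ j, j ≠ i ∧ (i, j) ∈ spans x w

namespace RecordsSpans

variable {x y : X} {w : List (RefSym A X)} {i : ℕ} {p : Bool × Bool × Bool}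

theorem unique {p' : Bool × Bool × Bool} (h : RecordsSpans x w i p) (h' : RecordsSpans x w i p') :
    p = p' :=
  Prod.ext (Bool.eq_iff_iff.2 (h.closes.trans h'.closes.symm)) <|
    Prod.ext (Bool.eq_iff_iff.2 (h.empty.trans h'.empty.symm))
      (Bool.eq_iff_iff.2 (h.opens.trans h'.opens.symm))

theorem letter_zero (x : X) (a : A) (w : List (RefSym A X)) :
    RecordsSpans x (.letter a :: w) 0 (false, false, false) where
  closes := by simp [spans, nextCls]
  empty := by simp [spans]
  opens := by simp [spans]

theorem letter_succ (h : RecordsSpans x w i p) (a : A) :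
    RecordsSpans x (.letter a :: w) (i + 1) p where
  closes := by
    rw [h.closes]
    simp [spans, nextCls]
  empty := by
    rw [h.empty]
    simp [spans]
  opens := by
    rw [h.opens]
    simp [spans]

theorem opn_of_ne (h : RecordsSpans x w i p) (hy : y ≠ x) : RecordsSpans x (.opn y :: w) i p where
  closes := by simpa [spans, nextCls, hy] using h.closes
  empty := by simpa [spans, hy] using h.empty
  opens := by simpa [spans, hy] using h.opens

theorem opn_zero (h : RecordsSpans x w 0 p) {j : ℕ} (hj : nextCls x w = some j) :
    RecordsSpans x (.opn x :: w) 0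
      (if p.1 then (false, true, p.2.2) else (false, p.2.1, true)) := by
  have hle : ∀ j' ≠ 0, (j', 0) ∉ spans x w := fun j' hj' h =>
    hj' (Nat.le_zero.1 (le_of_mem_spans _ h).1)
  have hp : p.1 = true ↔ j = 0 := by simpa [hj, hle] using h.closes
  by_cases hj0 : j = 0
  · subst hj0
    rw [if_pos (hp.2 rfl)]
    exact ⟨by simp [spans, nextCls, hj, hle], by simp [spans, hj], by simp [spans, hj, h.opens]⟩
  · rw [if_neg (hp.not.2 hj0)]
    refine ⟨by simp [spans, nextCls, hj, hle], by simp [spans, hj, h.empty, Ne.symm hj0], ?_⟩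
    have : ∃ j' ≠ 0, j' = j ∨ (0, j') ∈ spans x w := ⟨j, hj0, .inl rfl⟩
    simpa [spans, hj] using this

theorem opn_succ (h : RecordsSpans x w (i + 1) p) : RecordsSpans x (.opn x :: w) (i + 1) p where
  closes := by
    have (j : ℕ) : (j, i + 1) ∈ spans x (.opn x :: w) ↔
        (j = 0 ∧ nextCls x w = some (i + 1)) ∨ (j, i + 1) ∈ spans x w := by
      simp [spans, eq_comm, and_comm]
    simp [h.closes, this, nextCls, and_or_left, exists_or, or_comm]
  empty := by simp [spans, h.empty]
  opens := by simp [spans, h.opens]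

theorem opn (h : RecordsSpans x w i p) (hn : y = x → (nextCls x w).isSome) :
    RecordsSpans x (.opn y :: w) i
      (if i = 0 ∧ y = x then if p.1 then (false, true, p.2.2) else (false, p.2.1, true)
        else p) := by
  by_cases hy : y = x
  · subst hy
    obtain ⟨j, hj⟩ := Option.isSome_iff_exists.1 (hn rfl)
    cases i with
    | zero => simpa using h.opn_zero hj
    | succ i => simpa using h.opn_succ
  · simpa [hy] using h.opn_of_ne hy

theorem cls_of_ne (h : RecordsSpans x w i p) (hy : y ≠ x) : RecordsSpans x (.cls y :: w) i p where
  closes := by simpa [spans, nextCls, hy] using h.closes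
  empty := h.empty
  opens := h.opens

theorem cls_self (h : RecordsSpans x w i p) (hn : nextCls x w = none) :
    RecordsSpans x (.cls x :: w) i (if i = 0 then (true, p.2) else p) := by
  cases i with
  | zero => exact ⟨by simp [nextCls], h.empty, h.opens⟩
  | succ i => exact ⟨by simpa [spans, nextCls, hn] using h.closes, h.empty, h.opens⟩

theorem cls (h : RecordsSpans x w i p) (hn : y = x → nextCls x w = none) :
    RecordsSpans x (.cls y :: w) i (if i = 0 ∧ y = x then (true, p.2) else p) := by
  by_cases hy : y = x
  · subst hy
    simpa using h.cls_self (hn rfl)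
  · simpa [hy] using h.cls_of_ne hy

end RecordsSpans

theorem exists_of_getElem?_modifyHead_update {β : Type*} {l : List (X → β)} {y : X} {f : β → β}
    {i : ℕ} {z : X → β}
    (h : (l.modifyHead fun z => Function.update z y (f (z y)))[i]? = some z) :
    ∃ z₀, l[i]? = some z₀ ∧ ∀ x, z x = if i = 0 ∧ y = x then f (z₀ x) else z₀ x := by
  rw [List.getElem?_modifyHead] at h
  split_ifs at h with hi
  · obtain ⟨z₀, h₀, rfl⟩ := Option.map_eq_some_iff.1 h
    refine ⟨z₀, h₀, fun x => ?_⟩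
    by_cases hx : y = x
    · subst hx
      simp [hi]
    · simp [hx, Function.update_of_ne (Ne.symm hx)]
  · exact ⟨z, h, fun x => by simp [hi]⟩

theorem Alternating.recordsSpans_labels {x : X} {b : Bool} {w : List (RefSym A X)}
    (h : Alternating x b w) {i : ℕ} {z : Label X} (hz : (labels w)[i]? = some z) :
    RecordsSpans x w i (z x) := by
  induction w generalizing b i z with
  | nil =>
    obtain ⟨rfl, rfl⟩ : i = 0 ∧ z = fun _ => (false, false, false) := by
      cases i <;> simp_all [labels]
    exact ⟨by simp [spans, nextCls], by simp [spans], by simp [spans]⟩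
  | cons c w ih =>
    cases c with
    | letter a =>
      cases i with
      | zero =>
        cases hz
        exact .letter_zero x a w
      | succ i => exact (ih h hz).letter_succ a
    | opn y =>
      obtain ⟨z₀, h₀, hz⟩ := exists_of_getElem?_modifyHead_update
        (f := fun p => if p.1 then (false, true, p.2.2) else (false, p.2.1, true)) hz
      obtain ⟨b', h', hb'⟩ : ∃ b', Alternating x b' w ∧ (y = x → b' = true) := by
        rw [Alternating] at h
        split_ifs at h with hy
        · exact ⟨true, h.2, fun _ => rfl⟩
        · exact ⟨b, h, fun h => (hy h).elim⟩
      rw [hz]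
      exact (ih h' h₀).opn fun hy => by rw [h'.isSome_nextCls, hb' hy]
    | cls y =>
      obtain ⟨z₀, h₀, hz⟩ := exists_of_getElem?_modifyHead_update
        (f := fun p => (true, p.2)) hz
      obtain ⟨b', h', hb'⟩ : ∃ b', Alternating x b' w ∧ (y = x → b' = false) := by
        rw [Alternating] at h
        split_ifs at h with hy
        · exact ⟨false, h.2, fun _ => rfl⟩
        · exact ⟨b, h, fun h => (hy h).elim⟩
      rw [hz]
      exact (ih h' h₀).cls fun hy => by
        rw [← Option.isNone_iff_eq_none, ← Option.not_isSome, h'.isSome_nextCls, hb' hy]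
        rfl

end Labels

end ET

/-! ### Labels of multispan-tuples -/

namespace ET

/-- The bag of the words of a given length over a finite alphabet. -/
def words (Z : Type*) [Fintype Z] : ℕ → Multiset (List Z)
  | 0 => {[]}
  | n + 1 => Finset.univ.val.bind fun z => (words Z n).map fun l => z :: l

theorem mem_words {Z : Type*} [Fintype Z] {n : ℕ} {l : List Z} :
    l ∈ words Z n ↔ l.length = n := by
  induction n generalizing l with
  | zero => simp [words]
  | succ n ih => cases l <;> simp [words, ih]

theorem nodup_words (Z : Type*) [Fintype Z] (n : ℕ) : (words Z n).Nodup := by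
  induction n with
  | zero => exact Multiset.nodup_singleton _
  | succ n ih =>
    rw [words, Multiset.nodup_bind]
    refine ⟨fun z _ => ih.map List.cons_injective, Finset.univ.nodup.pairwise ?_⟩
    intro z _ z' _ hz
    rw [Function.onFun, Multiset.disjoint_left]
    simp only [Multiset.mem_map]
    rintro _ ⟨l, -, rfl⟩ ⟨l', -, h⟩
    exact hz (List.cons.inj h).1.symm

variable {A X : Type*}

open Classical in
/-- The label of a gap in a tuple. -/
noncomputable def tupleLabel {n : ℕ} (t : MultispanTuple n X) (i : Fin (n + 1)) : Label X :=
  fun x =>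
    (decide (∃ s ∈ t.1 x, s.finish = i ∧ s.start ≠ i),
      decide (∃ s ∈ t.1 x, s.start = i ∧ s.finish = i),
      decide (∃ s ∈ t.1 x, s.start = i ∧ s.finish ≠ i))

/-- The labels of all gaps in a tuple. -/
noncomputable def tupleLabels {n : ℕ} (t : MultispanTuple n X) : List (Label X) :=
  List.ofFn (tupleLabel t)

theorem Span.ext {n : ℕ} {s s' : Span n} (h : s.start = s'.start) (h' : s.finish = s'.finish) :
    s = s' :=
  Subtype.ext (Prod.ext h h')

theorem IsMultispan.finish_le_finish {n : ℕ} {S : Finset (Span n)} (hS : IsMultispan S)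
    {s s' : Span n} (hs : s ∈ S) (hs' : s' ∈ S) (h : s.start < s'.finish) :
    s.finish ≤ s'.finish := by
  by_cases heq : s = s'
  · rw [heq]
  · rcases hS s hs s' hs' heq with hd | hd
    · exact hd.trans s'.2
    · exact absurd hd h.not_ge

theorem subset_of_tupleLabel_eq {n : ℕ} {t t' : MultispanTuple n X} {x : X}
    (h : ∀ i, tupleLabel t i x = tupleLabel t' i x) : t.1 x ⊆ t'.1 x := by
  simp only [tupleLabel, Prod.mk.injEq, decide_eq_decide] at h
  intro s hs
  by_cases he : s.finish = s.start
  · obtain ⟨s', hs', hstart, hfinish⟩ := (h s.start).2.1.1 ⟨s, hs, rfl, he⟩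
    rwa [← Span.ext hstart (hfinish.trans he.symm)]
  · obtain ⟨s', hs', hstart, hne⟩ := (h s.start).2.2.1 ⟨s, hs, rfl, he⟩
    obtain ⟨s₁, hs₁, hfin₁, -⟩ := (h s.finish).1.1 ⟨s, hs, rfl, Ne.symm he⟩
    obtain ⟨s₂, hs₂, hfin₂, -⟩ := (h s'.finish).1.2 ⟨s', hs', rfl, by rwa [hstart, ne_comm]⟩
    have hlt : s'.start < s.finish := hstart ▸ lt_of_le_of_ne s.2 (Ne.symm he)
    have hlt' : s.start < s'.finish := hstart ▸ lt_of_le_of_ne s'.2 (hstart ▸ Ne.symm hne)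
    have hle : s'.finish ≤ s.finish := hfin₁ ▸ (t'.2 x).finish_le_finish hs' hs₁ (hfin₁ ▸ hlt)
    have hge : s.finish ≤ s'.finish := hfin₂ ▸ (t.2 x).finish_le_finish hs hs₂ (hfin₂ ▸ hlt')
    rwa [← Span.ext hstart (hle.antisymm hge)]

theorem tupleLabels_injective {n : ℕ} :
    Function.Injective (tupleLabels : MultispanTuple n X → List (Label X)) := by
  intro t t' h
  have h (x : X) (i : Fin (n + 1)) : tupleLabel t i x = tupleLabel t' i x :=
    congrFun (congrFun (List.ofFn_injective h) i) x
  exact Subtype.ext <| funext fun x => (subset_of_tupleLabel_eq (h x)).antisymm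
    (subset_of_tupleLabel_eq fun i => (h x i).symm)

section Word

variable [DecidableEq X] {w : List (RefSym A X)} {D : List A}

omit [DecidableEq X] in
theorem exists_multispanTuple (w : List (RefSym A X)) (n : ℕ) :
    ∃ t : MultispanTuple n X, ∀ x s, s ∈ t.1 x ↔ HasSpan w x s.start s.finish := by
  classical
  refine ⟨⟨fun x => Finset.univ.filter fun s => HasSpan w x s.start s.finish, ?_⟩, by simp⟩
  intro x s hs s' hs' hne
  simp only [Finset.mem_filter, hasSpan_iff_mem_spans] at hs hs'
  refine disjoint_of_mem_spans hs.2 hs'.2 fun h => hne ?_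
  exact Span.ext (Fin.ext (congrArg Prod.fst h)) (Fin.ext (congrArg Prod.snd h))

theorem exists_span_of_mem_spans (hD : doc w = D) {x : X} {i j : ℕ} (h : (i, j) ∈ spans x w) :
    ∃ s : Span D.length, (s.start : ℕ) = i ∧ (s.finish : ℕ) = j := by
  obtain ⟨hij, hj⟩ := le_of_mem_spans _ h
  rw [hD] at hj
  exact ⟨⟨(⟨i, by omega⟩, ⟨j, by omega⟩), hij⟩, rfl, rfl⟩

theorem recordsSpans_tupleLabel (hD : doc w = D) {t : MultispanTuple D.length X}
    (ht : ∀ x s, s ∈ t.1 x ↔ HasSpan w x s.start s.finish) {x : X} (hx : nextCls x w = none)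
    (i : Fin (D.length + 1)) : RecordsSpans x w i (tupleLabel t i x) := by
  simp only [hasSpan_iff_mem_spans] at ht
  constructor <;> simp only [tupleLabel, decide_eq_true_eq, hx, reduceCtorEq, or_false, ht]
  · constructor
    · rintro ⟨s, hs, rfl, hne⟩
      exact ⟨s.start, Fin.val_ne_of_ne hne, hs⟩
    · rintro ⟨j, hj, h⟩
      obtain ⟨s, rfl, hi⟩ := exists_span_of_mem_spans hD h
      obtain rfl := Fin.ext hi
      exact ⟨s, h, rfl, Fin.ne_of_val_ne hj⟩
  · constructor
    · rintro ⟨s, hs, rfl, hf⟩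
      rwa [hf] at hs
    · intro h
      obtain ⟨s, hi, hf⟩ := exists_span_of_mem_spans hD h
      exact ⟨s, by rwa [hi, hf], Fin.ext hi, Fin.ext hf⟩
  · constructor
    · rintro ⟨s, hs, rfl, hne⟩
      exact ⟨s.finish, Fin.val_ne_of_ne hne, hs⟩
    · rintro ⟨j, hj, h⟩
      obtain ⟨s, hi, rfl⟩ := exists_span_of_mem_spans hD h
      obtain rfl := Fin.ext hi
      exact ⟨s, h, rfl, Fin.ne_of_val_ne hj⟩

theorem tupleLabels_eq_labels (hw : ∀ x, Alternating x false w) (hD : doc w = D)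
    {t : MultispanTuple D.length X} (ht : ∀ x s, s ∈ t.1 x ↔ HasSpan w x s.start s.finish) :
    tupleLabels t = labels w := by
  refine List.ext_getElem (by simp [tupleLabels, length_labels, hD]) fun i hi hi' => ?_
  rw [tupleLabels, List.length_ofFn] at hi
  simp only [tupleLabels, List.getElem_ofFn]
  funext x
  have hx : nextCls x w = none := by simpa using (hw x).isSome_nextCls
  exact (recordsSpans_tupleLabel hD ht hx ⟨i, hi⟩).unique
    ((hw x).recordsSpans_labels (List.getElem?_eq_getElem hi'))

end Word

/-! ### Encodings in terms of labels -/

section Encoding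

variable [Fintype X] [LinearOrder X]

/-- The word of brackets described by a label. -/
def labelWord (z : Label X) : List (RefSym A X) :=
  (Finset.univ.sort (fun x y : X => x ≤ y)).flatMap fun x =>
    (if (z x).1 then [RefSym.cls x] else []) ++
      (if (z x).2.1 then [RefSym.opn x, RefSym.cls x] else []) ++
      (if (z x).2.2 then [RefSym.opn x] else [])

/-- The encoding of a document and the list of the labels of its gaps. -/
def encodeLabels : List (Label X) → List A → List (RefSym A X)
  | [], _ => []
  | z :: _, [] => labelWord z
  | z :: zs, a :: D => labelWord z ++ RefSym.letter a :: encodeLabels zs D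

theorem encodeLabels_ofFn (D : List A) (h : Fin (D.length + 1) → Label X) :
    encodeLabels (List.ofFn h) D =
      (List.finRange D.length).flatMap
          (fun i => labelWord (h i.castSucc) ++ [RefSym.letter (D.get i)]) ++
        labelWord (h (Fin.last D.length)) := by
  induction D with
  | nil => simp [encodeLabels]
  | cons a D ih =>
    rw [List.ofFn_succ]
    refine (congrArg (labelWord (h 0) ++ RefSym.letter a :: ·) (ih fun i => h i.succ)).trans ?_
    simp [List.finRange_succ, List.flatMap_map]

theorem encode_eq_encodeLabels (D : List A) (t : MultispanTuple D.length X) :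
    encode D t = encodeLabels (tupleLabels t) D := by
  have hgap (i : Fin (D.length + 1)) :
      gap t i = (labelWord (tupleLabel t i) : List (RefSym A X)) := by
    simp only [gap, labelWord, gapVar, tupleLabel, decide_eq_true_eq]
  simp only [encode, hgap, tupleLabels, encodeLabels_ofFn]

open Classical in
theorem map_tupleLabels (R : Expr A X) (hR : R.WellFormed) (D : List A) :
    (Set.toFinite (languageMultispanner R.lang D)).toFinset.val.map tupleLabels =
      (words (Label X) (D.length + 1)).filter fun zs =>
        ∃ w ∈ R.lang, doc w = D ∧ labels w = zs := by
  refine (Multiset.Nodup.ext ((Finset.nodup _).map tupleLabels_injective)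
    ((nodup_words _ _).filter _)).2 fun zs => ?_
  simp only [Multiset.mem_map, Finset.mem_val, Set.Finite.mem_toFinset, Multiset.mem_filter,
    mem_words]
  constructor
  · rintro ⟨t, ⟨w, hw, hD, ht⟩, rfl⟩
    exact ⟨List.length_ofFn, w, hw, hD, (tupleLabels_eq_labels (hR.alternating hw) hD ht).symm⟩
  · rintro ⟨-, w, hw, hD, rfl⟩
    obtain ⟨t, ht⟩ := exists_multispanTuple w D.length
    exact ⟨t, ⟨w, hw, hD, ht⟩, tupleLabels_eq_labels (hR.alternating hw) hD ht⟩

theorem eval_eq_filterMap_words {B : Type*} {P : Program A X B} {R : Expr A X}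
    (hR : R.WellFormed) (hE : P.E = languageMultispanner R.lang) (D : List A) :
    open Classical in P.eval D = ((words (Label X) (D.length + 1)).filter fun zs =>
        ∃ w ∈ R.lang, doc w = D ∧ labels w = zs).filterMap fun zs => P.T (encodeLabels zs D) := by
  obtain ⟨E, T⟩ := P
  subst hE
  rw [← map_tupleLabels R hR, Multiset.filterMap_map]
  simp only [Program.eval, encode_eq_encodeLabels, Function.comp_def]

end Encoding

end ET

/-! ### Regularity of the languages of expressions -/

namespace ET

section Regular

variable {A : Type*} {L M : Language A}

theorem isRegular_of_finite (hL : Set.Finite (L : Set (List A))) : L.IsRegular := by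
  refine .of_finite_range_leftQuotient
    ((hL.biUnion fun w _ => w.tails.finite_toSet).finite_subsets.subset ?_)
  rintro _ ⟨u, rfl⟩ v (hv : u ++ v ∈ L)
  exact Set.mem_biUnion hv ((List.mem_tails v (u ++ v)).2 (List.suffix_append u v))

theorem leftQuotient_mul (w : List A) :
    (L * M).leftQuotient w = L.leftQuotient w * M +
      sSup {Q | ∃ u v, u ++ v = w ∧ u ∈ L ∧ Q = M.leftQuotient v} := by
  ext y
  constructor
  · rintro ⟨u, hu, v, hv, h⟩
    rcases List.append_eq_append_iff.1 h with ⟨c, rfl, rfl⟩ | ⟨c, rfl, rfl⟩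
    · exact .inr ⟨_, ⟨u, c, rfl, hu, rfl⟩, hv⟩
    · exact .inl ⟨c, hu, v, hv, rfl⟩
  · rintro (⟨u, hu, v, hv, rfl⟩ | ⟨_, ⟨u, v, rfl, hu, rfl⟩, hy⟩)
    · exact ⟨w ++ u, hu, v, hv, by simp⟩
    · exact ⟨u, hu, v ++ y, hy, by simp⟩

theorem isRegular_mul (hL : L.IsRegular) (hM : M.IsRegular) : (L * M).IsRegular := by
  refine .of_finite_range_leftQuotient ((hL.finite_range_leftQuotient.image2
    (fun P S => P * M + sSup S) hM.finite_range_leftQuotient.finite_subsets).subset ?_)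
  rintro _ ⟨w, rfl⟩
  rw [leftQuotient_mul]
  refine Set.mem_image2_of_mem ⟨w, rfl⟩ ?_
  rintro _ ⟨u, v, -, -, rfl⟩
  exact ⟨v, rfl⟩

open scoped Computability

theorem exists_of_append_mem_kstar {w y : List A} (hw : w ≠ []) (h : w ++ y ∈ L∗) :
    ∃ u v, u ++ v = w ∧ u ∈ L∗ ∧ y ∈ L.leftQuotient v * L∗ := by
  obtain ⟨l, h, hl⟩ := h
  induction l generalizing w with
  | nil => exact absurd (List.append_eq_nil_iff.1 h).1 hw
  | cons x l ih =>
    obtain ⟨hx, hl'⟩ := List.forall_mem_cons.1 hl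
    rw [List.flatten_cons] at h
    rcases List.append_eq_append_iff.1 h with ⟨c, rfl, rfl⟩ | ⟨c, rfl, h'⟩
    · exact ⟨[], w, rfl, Language.nil_mem_kstar L, c, hx, _, ⟨l, rfl, hl'⟩, rfl⟩
    · by_cases hc : c = []
      · subst hc
        have hx' : x ++ [] ∈ L := by rwa [List.append_nil]
        exact ⟨[], x, by simp, Language.nil_mem_kstar L, [], hx', y, ⟨l, h'.symm, hl'⟩, rfl⟩
      · obtain ⟨u, v, rfl, ⟨k, rfl, hk⟩, hy⟩ := ih hc h'.symm hl'
        exact ⟨x ++ k.flatten, v, List.append_assoc .., ⟨x :: k, rfl,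
          List.forall_mem_cons.2 ⟨hx, hk⟩⟩, hy⟩

theorem leftQuotient_kstar {w : List A} (hw : w ≠ []) :
    L∗.leftQuotient w =
      sSup {Q | ∃ u v, u ++ v = w ∧ u ∈ L∗ ∧ Q = L.leftQuotient v} * L∗ := by
  ext y
  constructor
  · intro h
    obtain ⟨u, v, huv, hu, a, ha, b, hb, rfl⟩ := exists_of_append_mem_kstar hw h
    exact ⟨a, ⟨_, ⟨u, v, huv, hu, rfl⟩, ha⟩, b, hb, rfl⟩
  · rintro ⟨a, ⟨_, ⟨u, v, rfl, ⟨l, rfl, hl⟩, rfl⟩, ha⟩, _, ⟨l', rfl, hl'⟩, rfl⟩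
    refine ⟨l ++ (v ++ a) :: l', by simp, ?_⟩
    rw [List.forall_mem_append, List.forall_mem_cons]
    exact ⟨hl, ha, hl'⟩

theorem isRegular_kstar (hL : L.IsRegular) : L∗.IsRegular := by
  refine .of_finite_range_leftQuotient (((hL.finite_range_leftQuotient.finite_subsets.image
    fun S => sSup S * L∗).insert L∗).subset ?_)
  rintro _ ⟨w, rfl⟩
  by_cases hw : w = []
  · rw [hw, Language.leftQuotient_nil]
    exact Set.mem_insert _ _
  · rw [leftQuotient_kstar hw]
    refine Set.mem_insert_of_mem _ (Set.mem_image_of_mem _ ?_)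
    rintro _ ⟨u, v, -, -, rfl⟩
    exact ⟨v, rfl⟩

theorem Expr.isRegular_lang {X : Type*} (R : Expr A X) : R.lang.IsRegular := by
  have singleton (w : List (RefSym A X)) : ({w} : Language (RefSym A X)).IsRegular :=
    isRegular_of_finite (Set.finite_singleton w)
  induction R with
  | eps => exact singleton []
  | sym a => exact singleton _
  | cat R R' ih ih' => exact isRegular_mul ih ih'
  | alt R R' ih ih' => exact ih.add ih'
  | star R ih => exact isRegular_kstar ih
  | bind x R ih => exact isRegular_mul (isRegular_mul (singleton _) ih) (singleton _)

end Regular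

end ET

/-! ### Runs of deterministic streaming string transducers -/

namespace ET

namespace DSST

attribute [instance] DSST.finQ DSST.finR DSST.decR

variable {A B : Type*} (𝒯 : DSST A B)

theorem nodup_regs_of_mem_Δ {q : 𝒯.Q} {a : A} {r : Assignment 𝒯.R B × 𝒯.Q}
    (h : r ∈ 𝒯.Δ q a) : r.1.regs.Nodup :=
  Assignment.copyless_iff_nodup_regs.1 (𝒯.copyless q a r.1 r.2 h)

theorem nodup_regs_of_mem_F {q : 𝒯.Q} {w : List (𝒯.R ⊕ B)} (h : w ∈ 𝒯.F q) : (regs w).Nodup :=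
  (nodup_regs_iff w).2 (𝒯.final_once q w h)

/-- The assignment and the state after reading a word. -/
def run : List A → 𝒯.Q → Option (Assignment 𝒯.R B × 𝒯.Q)
  | [], q => some (.identity, q)
  | a :: w, q => (𝒯.Δ q a).bind fun p => (run w p.2).map fun r => (p.1.comp r.1, r.2)

/-- The output of the run from a state, as a word over the output letters and the initial contents
of the registers. -/
def symbolicOutput : List A → 𝒯.Q → Option (List (𝒯.R ⊕ B))
  | [], q => 𝒯.F q
  | a :: w, q => (𝒯.Δ q a).bind fun r => (symbolicOutput w r.2).bind r.1.apply

theorem nodup_regs_of_mem_run {w : List A} {q : 𝒯.Q} {r : Assignment 𝒯.R B × 𝒯.Q}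
    (h : r ∈ 𝒯.run w q) : r.1.regs.Nodup := by
  induction w generalizing q r with
  | nil =>
    simp only [run, Option.mem_def, Option.some.injEq] at h
    rw [← h, Assignment.regs_identity]
    exact Finset.univ.nodup
  | cons a w ih =>
    simp only [run, Option.mem_def, Option.bind_eq_some_iff, Option.map_eq_some_iff] at h
    obtain ⟨p, hp, r, hr, rfl⟩ := h
    exact Multiset.nodup_of_le (Assignment.regs_comp_le _ (ih hr)) (𝒯.nodup_regs_of_mem_Δ hp)

theorem nodup_regs_of_mem_symbolicOutput {w : List A} {q : 𝒯.Q} {v : List (𝒯.R ⊕ B)}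
    (h : v ∈ 𝒯.symbolicOutput w q) : (regs v).Nodup := by
  induction w generalizing q v with
  | nil => exact 𝒯.nodup_regs_of_mem_F h
  | cons a w ih =>
    simp only [symbolicOutput, Option.mem_def, Option.bind_eq_some_iff] at h
    obtain ⟨r, hr, u, hu, huv⟩ := h
    exact Assignment.nodup_regs_of_apply (𝒯.nodup_regs_of_mem_Δ hr) (ih hu) huv

theorem symbolicOutput_append (u v : List A) (q : 𝒯.Q) :
    𝒯.symbolicOutput (u ++ v) q =
      (𝒯.run u q).bind fun r => (𝒯.symbolicOutput v r.2).bind r.1.apply := by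
  induction u generalizing q with
  | nil => simp [run, Assignment.apply_identity]
  | cons a u ih =>
    simp only [List.cons_append, symbolicOutput, run, ih, Option.bind_assoc, Option.bind_map,
      Function.comp_def, funext (Assignment.apply_comp _ _)]

theorem evalFrom_eq_symbolicOutput (w : List A) (q : 𝒯.Q) (ν : Valuation 𝒯.R B) :
    𝒯.evalFrom w q ν = (𝒯.symbolicOutput w q).bind ν.extend := by
  induction w generalizing q ν with
  | nil => rfl
  | cons a w ih =>
    simp only [evalFrom, symbolicOutput, ih, Option.bind_assoc,
      funext (Valuation.extend_comp ν _)]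

theorem eval_eq_map_letters (w : List A) :
    𝒯.eval w = (𝒯.symbolicOutput w 𝒯.q₀).map letters := by
  rw [eval, evalFrom_eq_symbolicOutput, funext Valuation.extend_const_nil, Option.map_eq_bind]
  rfl

/-! ### Linear growth -/

theorem exists_length_letters_le [Finite A] : ∃ K : ℕ, ∀ w q, ∀ v ∈ 𝒯.symbolicOutput w q,
    (letters v).length ≤ K * (w.length + 1) := by
  obtain ⟨K₁, hK₁⟩ := Finite.exists_le fun p : 𝒯.Q × A =>
    (𝒯.Δ p.1 p.2).elim 0 fun r => r.1.letters.card
  obtain ⟨K₂, hK₂⟩ := Finite.exists_le fun q : 𝒯.Q => (𝒯.F q).elim 0 fun w => (letters w).length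
  refine ⟨K₁ + K₂, fun w => ?_⟩
  induction w with
  | nil =>
    intro q v (h : 𝒯.F q = some v)
    have := hK₂ q
    simp only [h, Option.elim_some] at this
    simpa using this.trans (Nat.le_add_left K₂ K₁)
  | cons a w ih =>
    intro q v h
    simp only [symbolicOutput, Option.mem_def, Option.bind_eq_some_iff] at h
    obtain ⟨r, hr, u, hu, huv⟩ := h
    have hr' := hK₁ (q, a)
    simp only [hr, Option.elim_some] at hr'
    have hv := Multiset.card_le_card
      (r.1.letters_le_of_apply (𝒯.nodup_regs_of_mem_symbolicOutput hu) huv)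
    rw [Multiset.card_add, Multiset.coe_card, Multiset.coe_card] at hv
    have := ih r.2 u hu
    rw [List.length_cons, Nat.mul_succ (K₁ + K₂)]
    omega

theorem hasLinearGrowth [Finite A] (h : 𝒯.eval [] = none) : HasLinearGrowth 𝒯.eval := by
  obtain ⟨K, hK⟩ := 𝒯.exists_length_letters_le
  refine ⟨2 * K, fun w v hv => ?_⟩
  cases w with
  | nil => simp [h] at hv
  | cons a w =>
    rw [eval_eq_map_letters, Option.map_eq_some_iff] at hv
    obtain ⟨u, hu, rfl⟩ := hv
    calc (letters u).length
      _ ≤ K * ((a :: w).length + 1) := hK _ _ u hu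
      _ ≤ K * (2 * (a :: w).length) := by gcongr; rw [List.length_cons]; omega
      _ = 2 * K * (a :: w).length := by ring

end DSST

end ET

/-! ### From linear programs to nondeterministic streaming string transducers -/

namespace ET

section GapLabels

variable {A X : Type*}

theorem exists_eq_append_of_doc_eq_cons {w : List (RefSym A X)} {a : A} {D : List A}
    (h : doc w = a :: D) : ∃ g w', w = g ++ RefSym.letter a :: w' ∧ doc g = [] ∧ doc w' = D := by
  induction w with
  | nil => simp [doc] at h
  | cons c w ih =>
    cases c with
    | letter b =>
      simp only [doc, List.cons.injEq] at h
      obtain ⟨rfl, h⟩ := h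
      exact ⟨[], w, rfl, rfl, h⟩
    | opn x =>
      obtain ⟨g, w', rfl, hg, hw'⟩ := ih h
      exact ⟨.opn x :: g, w', rfl, hg, hw'⟩
    | cls x =>
      obtain ⟨g, w', rfl, hg, hw'⟩ := ih h
      exact ⟨.cls x :: g, w', rfl, hg, hw'⟩

theorem labels_append_letter [DecidableEq X] (u : List (RefSym A X)) (a : A)
    (v : List (RefSym A X)) : labels (u ++ RefSym.letter a :: v) = labels u ++ labels v := by
  induction u with
  | nil => rfl
  | cons c u ih =>
    have modifyHead_append (f : Label X → Label X) :
        (labels u ++ labels v).modifyHead f = (labels u).modifyHead f ++ labels v := by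
      cases h : labels u with
      | nil => simpa [h] using length_labels u
      | cons z zs => rfl
    cases c <;> simp [labels, ih, modifyHead_append]

variable {σ : Type*} (M : DFA (RefSym A X) σ)

/-- The states of an automaton after words of brackets with a given label. -/
def statesAfter [DecidableEq X] (S : Set σ) (z : Label X) : Set σ :=
  {s' | ∃ s ∈ S, ∃ g, doc g = [] ∧ labels g = [z] ∧ M.evalFrom s g = s'}

/-- From some state in `S`, the automaton accepts a word with given document and labels. -/
def AcceptsLabels [DecidableEq X] (S : Set σ) (D : List A) (zs : List (Label X)) : Prop :=
  ∃ s ∈ S, ∃ w, M.evalFrom s w ∈ M.accept ∧ doc w = D ∧ labels w = zs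

variable [DecidableEq X]

theorem acceptsLabels_nil (S : Set σ) (z : Label X) :
    AcceptsLabels M S [] [z] ↔ ∃ s ∈ statesAfter M S z, s ∈ M.accept := by
  constructor
  · rintro ⟨s, hs, w, h, hd, hl⟩
    exact ⟨_, ⟨s, hs, w, hd, hl, rfl⟩, h⟩
  · rintro ⟨_, ⟨s, hs, w, hd, hl, rfl⟩, h⟩
    exact ⟨s, hs, w, h, hd, hl⟩

theorem acceptsLabels_cons (S : Set σ) (a : A) (D : List A) (z : Label X) (zs : List (Label X)) :
    AcceptsLabels M S (a :: D) (z :: zs) ↔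
      AcceptsLabels M ((fun s => M.step s (.letter a)) '' statesAfter M S z) D zs := by
  constructor
  · rintro ⟨s, hs, w, h, hd, hl⟩
    obtain ⟨g, w, rfl, hg, rfl⟩ := exists_eq_append_of_doc_eq_cons hd
    obtain ⟨z', hz'⟩ : ∃ z', labels g = [z'] :=
      List.length_eq_one_iff.1 (by rw [length_labels, hg]; rfl)
    rw [labels_append_letter, hz', List.singleton_append, List.cons.injEq] at hl
    obtain ⟨rfl, rfl⟩ := hl
    refine ⟨_, ⟨_, ⟨s, hs, g, hg, hz', rfl⟩, rfl⟩, w, ?_, rfl, rfl⟩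
    simpa [DFA.evalFrom_of_append] using h
  · rintro ⟨_, ⟨_, ⟨s, hs, g, hg, hz, rfl⟩, rfl⟩, w, h, rfl, rfl⟩
    refine ⟨s, hs, g ++ .letter a :: w, ?_, by simp [doc_append, hg, doc], ?_⟩
    · simpa [DFA.evalFrom_of_append] using h
    · rw [labels_append_letter, hz, List.singleton_append]

end GapLabels

section OfProgram

variable {A X B : Type*} [Fintype X] [LinearOrder X] {σ : Type} [Fintype σ]

open Classical in
/-- The transducer that guesses the labels of all gaps and runs `𝒯` on the resulting encoding. With
the set of states that `M` can reach on words with these labels it checks that `M` accepts one. -/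
@[reducible] noncomputable def NSST.ofProgram (𝒯 : DSST (RefSym A X) B)
    (M : DFA (RefSym A X) σ) : NSST A B where
  Q := 𝒯.Q × Set σ
  R := 𝒯.R
  δ s a := Finset.univ.val.filterMap fun z =>
    (𝒯.run (labelWord z ++ [.letter a]) s.1).map fun r =>
      (r.1, r.2, (fun s' => M.step s' (.letter a)) '' statesAfter M s.2 z)
  copyless s a := by
    simp only [Multiset.mem_filterMap, Option.map_eq_some_iff]
    rintro _ ⟨z, -, r, hr, rfl⟩
    exact 𝒯.nodup_regs_of_mem_run hr
  q₀ := (𝒯.q₀, {M.start})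
  F s := (Finset.univ.val.filter fun z => ∃ s' ∈ statesAfter M s.2 z, s' ∈ M.accept).filterMap
    fun z => 𝒯.symbolicOutput (labelWord z) s.1
  final_once s := by
    simp only [Multiset.mem_filterMap]
    rintro v ⟨z, -, hv⟩
    exact 𝒯.nodup_regs_of_mem_symbolicOutput hv

open Classical in
theorem NSST.symbolicOutputs_ofProgram (𝒯 : DSST (RefSym A X) B) (M : DFA (RefSym A X) σ)
    (D : List A) (q : 𝒯.Q) (S : Set σ) :
    (NSST.ofProgram 𝒯 M).symbolicOutputs D (q, S) =
      ((words (Label X) (D.length + 1)).filter (AcceptsLabels M S D)).filterMap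
        fun zs => 𝒯.symbolicOutput (encodeLabels zs D) q := by
  induction D generalizing q S with
  | nil =>
    simp [symbolicOutputs, words, Multiset.filter_map, Multiset.filterMap_map, Function.comp_def,
      acceptsLabels_nil, encodeLabels]
  | cons a D ih =>
    have append (z : Label X) (zs : List (Label X)) :
        𝒯.symbolicOutput (labelWord z ++ RefSym.letter a :: encodeLabels zs D) q =
          (𝒯.run (labelWord z ++ [.letter a]) q).bind fun r =>
            (𝒯.symbolicOutput (encodeLabels zs D) r.2).bind r.1.apply := by
      rw [← DSST.symbolicOutput_append, List.append_assoc, List.singleton_append]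
    rw [List.length_cons, words, Multiset.filter_bind, Multiset.filterMap_bind, symbolicOutputs,
      Multiset.bind_filterMap]
    refine Multiset.bind_congr fun z _ => ?_
    simp only [Multiset.filter_map, Multiset.filterMap_map, Function.comp_def, acceptsLabels_cons,
      encodeLabels, append]
    cases 𝒯.run (labelWord z ++ [.letter a]) q with
    | none => exact (Multiset.eq_zero_of_forall_notMem (by simp)).symm
    | some r => simp [ih, Multiset.filterMap_filterMap]

theorem Program.IsLinear.exists_nsst {P : Program A X B} (h : P.IsLinear) :
    ∃ N : NSST A B, ∀ D, N.eval D = P.eval D := by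
  classical
  obtain ⟨⟨R, hR, hE⟩, 𝒯, hT⟩ := h
  obtain ⟨σ, _, M, hM⟩ := R.isRegular_lang
  have acceptsLabels_iff (D : List A) (zs : List (Label X)) :
      AcceptsLabels M {M.start} D zs ↔ ∃ w ∈ R.lang, doc w = D ∧ labels w = zs := by
    simp only [AcceptsLabels, Set.mem_singleton_iff, exists_eq_left, ← hM]
    rfl
  refine ⟨.ofProgram 𝒯 M, fun D => ?_⟩
  rw [eval_eq_filterMap_words hR hE, hT, NSST.eval, NSST.symbolicOutputs_ofProgram,
    Multiset.map_filterMap]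
  simp only [acceptsLabels_iff, DSST.eval_eq_map_letters]

end OfProgram

end ET

/-! ### Expressions for documents with a marker at every position -/

namespace ET

variable {A X : Type*}

theorem append_mem_kstar_mul {L M : Language A} {u w : List A} (hu : u ∈ L)
    (hw : w ∈ KStar.kstar L * M) : u ++ w ∈ KStar.kstar L * M := by
  obtain ⟨_, ⟨l, rfl, hl⟩, v, hv, rfl⟩ := hw
  exact ⟨_, ⟨u :: l, rfl, List.forall_mem_cons.2 ⟨hu, hl⟩⟩, v, hv, by simp⟩

theorem kstar_mul_induction {L M : Language A} {p : List A → Prop} (mul : ∀ w ∈ M, p w)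
    (append : ∀ u ∈ L, ∀ w, p w → p (u ++ w)) : ∀ w ∈ KStar.kstar L * M, p w := by
  rintro _ ⟨_, ⟨l, rfl, hl⟩, v, hv, rfl⟩
  induction l with
  | nil => exact mul v hv
  | cons u l ih =>
    obtain ⟨hu, hl⟩ := List.forall_mem_cons.1 hl
    simpa using append u hu _ (ih hl)

namespace Expr

/-- The sum of the expressions in a list and one further expression, which is there since no
expression defines the empty language. -/
def sum (R : Expr A X) (l : List (Expr A X)) : Expr A X := l.foldr .alt R

theorem mem_lang_sum (R : Expr A X) (l : List (Expr A X)) (w : List (RefSym A X)) :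
    w ∈ (sum R l).lang ↔ w ∈ R.lang ∨ ∃ R' ∈ l, w ∈ R'.lang := by
  induction l with
  | nil => simp [sum]
  | cons R' l ih =>
    have hcons : w ∈ (sum R (R' :: l)).lang ↔ w ∈ R'.lang ∨ w ∈ (sum R l).lang := Iff.rfl
    simp only [hcons, ih, List.mem_cons, exists_eq_or_imp, or_left_comm]

theorem wellFormed_sum {R : Expr A X} {l : List (Expr A X)} (hR : R.WellFormed)
    (hl : ∀ R' ∈ l, R'.WellFormed) : (sum R l).WellFormed := by
  induction l with
  | nil => exact hR
  | cons R' l ih =>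
    obtain ⟨hR', hl⟩ := List.forall_mem_cons.1 hl
    exact ⟨hR', ih hl⟩

/-- The expression for an empty span of `x`. -/
def mark (x : X) : Expr A X := .bind x .eps

theorem mem_lang_mark (x : X) (w : List (RefSym A X)) :
    w ∈ (mark x).lang ↔ w = [.opn x, .cls x] := by
  constructor
  · rintro ⟨_, ⟨_, rfl, _, rfl, rfl⟩, _, rfl, rfl⟩
    rfl
  · rintro rfl
    exact ⟨_, ⟨_, rfl, _, rfl, rfl⟩, _, rfl, rfl⟩

variable [Fintype A] [Fintype X]

/-- The expression for all documents with exactly one variable marked at every position. -/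
noncomputable def marked (x₀ : X) : Expr A X :=
  .cat (.star (sum .eps ((Finset.univ : Finset (X × A)).toList.map fun p =>
      .cat (mark p.1) (.sym p.2))))
    (sum (mark x₀) ((Finset.univ : Finset X).toList.map mark))

theorem wellFormed_marked (x₀ : X) : (marked x₀ : Expr A X).WellFormed := by
  refine ⟨wellFormed_sum trivial ?_, wellFormed_sum ⟨id, trivial⟩ ?_⟩
  · rw [List.forall_mem_map]
    exact fun p _ => ⟨⟨id, trivial⟩, trivial⟩
  · rw [List.forall_mem_map]
    exact fun x _ => ⟨id, trivial⟩

end Expr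

/-- The word for a document with one variable marked at every position. -/
def markedWord : List X → List A → List (RefSym A X)
  | [], _ => []
  | x :: _, [] => [.opn x, .cls x]
  | x :: xs, a :: D => .opn x :: .cls x :: .letter a :: markedWord xs D

theorem markers_induction {p : List X → List A → Prop} (nil : ∀ x, p [x] [])
    (cons : ∀ x xs a D, p xs D → p (x :: xs) (a :: D)) {xs : List X} {D : List A}
    (h : xs.length = D.length + 1) : p xs D := by
  induction D generalizing xs with
  | nil =>
    obtain ⟨x, rfl⟩ := List.length_eq_one_iff.1 h
    exact nil x
  | cons a D ih =>
    cases xs with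
    | nil => simp at h
    | cons x xs => exact cons x xs a D (ih (by simpa using h))

theorem doc_markedWord {xs : List X} {D : List A} (h : xs.length = D.length + 1) :
    doc (markedWord xs D) = D := by
  refine markers_induction (p := fun xs D => doc (markedWord xs D) = D) (fun _ => rfl)
    (fun x xs a D ih => ?_) h
  simp [markedWord, doc, ih]

section Lang

variable [Fintype A] [Fintype X]

theorem markedWord_mem_lang_marked (x₀ : X) {xs : List X} {D : List A}
    (h : xs.length = D.length + 1) : markedWord xs D ∈ (Expr.marked x₀ : Expr A X).lang := by
  refine markers_induction (p := fun xs D => markedWord xs D ∈ (Expr.marked x₀).lang)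
    (fun x => ?_) (fun x xs a D ih => ?_) h
  · refine ⟨[], Language.nil_mem_kstar _, _, (Expr.mem_lang_sum ..).2 (.inr ?_), rfl⟩
    exact ⟨_, List.mem_map_of_mem (by simp), (Expr.mem_lang_mark x _).2 rfl⟩
  · refine append_mem_kstar_mul (u := [.opn x, .cls x, .letter a])
      ((Expr.mem_lang_sum ..).2 (.inr ?_)) ih
    exact ⟨_, List.mem_map_of_mem (a := (x, a)) (by simp),
      _, (Expr.mem_lang_mark x _).2 rfl, _, rfl, rfl⟩

theorem exists_eq_markedWord {x₀ : X} {w : List (RefSym A X)} (hw : w ∈ (Expr.marked x₀).lang) :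
    ∃ xs D, xs.length = D.length + 1 ∧ w = markedWord xs D := by
  refine kstar_mul_induction
    (p := fun w => ∃ xs D, xs.length = D.length + 1 ∧ w = markedWord xs D)
    (fun v hv => ?_) (fun u hu w ih => ?_) w hw
  · obtain ⟨x, hx⟩ : ∃ x, v ∈ (Expr.mark x).lang := by
      rcases (Expr.mem_lang_sum ..).1 hv with hv | ⟨_, hR, hv⟩
      · exact ⟨x₀, hv⟩
      · obtain ⟨x, -, rfl⟩ := List.mem_map.1 hR
        exact ⟨x, hv⟩
    exact ⟨[x], [], rfl, (Expr.mem_lang_mark x v).1 hx⟩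
  · obtain ⟨xs, D, hxs, rfl⟩ := ih
    rcases (Expr.mem_lang_sum ..).1 hu with rfl | ⟨_, hR, hu⟩
    · exact ⟨xs, D, hxs, rfl⟩
    · obtain ⟨⟨x, a⟩, -, rfl⟩ := List.mem_map.1 hR
      obtain ⟨v, hv, _, rfl, rfl⟩ := hu
      rw [(Expr.mem_lang_mark x v).1 hv]
      exact ⟨x :: xs, a :: D, by simp [hxs], rfl⟩

end Lang

section MarkLabel

variable [DecidableEq X]

/-- The label of a gap in which only the empty span of `x` is marked. -/
def markLabel (x : X) : Label X :=
  Function.update (fun _ => (false, false, false)) x (false, true, false)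

theorem markLabel_injective : Function.Injective (markLabel : X → Label X) := by
  intro x y h
  by_contra hne
  have := congrFun h x
  simp [markLabel, Function.update_of_ne hne] at this

theorem labels_markedWord {xs : List X} {D : List A} (h : xs.length = D.length + 1) :
    labels (markedWord xs D) = xs.map markLabel := by
  refine markers_induction (p := fun xs D => labels (markedWord xs D) = xs.map markLabel)
    (fun x => ?_) (fun x xs a D ih => ?_) h
  · simp [markedWord, labels, markLabel]
  · simp [markedWord, labels, markLabel, ih]

open Classical in
theorem map_map_markLabel_words [Fintype A] [Fintype X] (x₀ : X) (D : List A) :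
    (words X (D.length + 1)).map (List.map markLabel) =
      (words (Label X) (D.length + 1)).filter fun zs =>
        ∃ w ∈ (Expr.marked x₀).lang, doc w = D ∧ labels w = zs := by
  refine (Multiset.Nodup.ext ((nodup_words _ _).map
    (List.map_injective_iff.2 markLabel_injective)) ((nodup_words _ _).filter _)).2 fun zs => ?_
  simp only [Multiset.mem_map, Multiset.mem_filter, mem_words]
  constructor
  · rintro ⟨xs, hxs, rfl⟩
    exact ⟨by simpa using hxs, _, markedWord_mem_lang_marked x₀ hxs, doc_markedWord hxs,
      labels_markedWord hxs⟩
  · rintro ⟨-, w, hw, rfl, rfl⟩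
    obtain ⟨xs, D, hxs, rfl⟩ := exists_eq_markedWord hw
    exact ⟨xs, by rw [doc_markedWord hxs, hxs], (labels_markedWord hxs).symm⟩

end MarkLabel

theorem flatMap_eq_of_unique {L M : Type*} {l : List L} (hl : l.Nodup) {f : L → List M} {k : L}
    (hk : k ∈ l) (h : ∀ x, x ≠ k → f x = []) : l.flatMap f = f k := by
  obtain ⟨s, t, rfl⟩ := List.append_of_mem hk
  rw [List.nodup_middle, List.nodup_cons, List.mem_append, not_or] at hl
  have nil {r : List L} (hr : k ∉ r) : r.flatMap f = [] :=
    List.flatMap_eq_nil_iff.2 fun x hx => h x (ne_of_mem_of_not_mem hx hr)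
  rw [List.flatMap_append, List.flatMap_cons, nil hl.1.1, nil hl.1.2, List.append_nil,
    List.nil_append]

theorem labelWord_markLabel [Fintype X] [LinearOrder X] (x : X) :
    (labelWord (markLabel x) : List (RefSym A X)) = [.opn x, .cls x] := by
  rw [labelWord, flatMap_eq_of_unique (Finset.sort_nodup _ _) (k := x) (by simp)]
  · simp [markLabel]
  · intro y hy
    simp [markLabel, hy]

theorem encodeLabels_markLabel [Fintype X] [LinearOrder X] (xs : List X) (D : List A) :
    encodeLabels (xs.map markLabel) D = markedWord xs D := by
  induction D generalizing xs with
  | nil => cases xs <;> simp [encodeLabels, markedWord, labelWord_markLabel]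
  | cons a D ih => cases xs <;> simp [encodeLabels, markedWord, labelWord_markLabel, ih]

end ET

/-! ### From nondeterministic to deterministic transducers -/

namespace ET

variable {A C : Type*}

theorem univ_filterMap_getElem? {β : Type*} {m : ℕ} {s : Multiset β} (h : s.card ≤ m) :
    (Finset.univ : Finset (Fin m)).val.filterMap (fun k => s.toList[k.1]?) = s := by
  have key (m : ℕ) (l : List β) (h : l.length ≤ m) :
      (List.finRange m).filterMap (fun k => l[k.1]?) = l := by
    induction l generalizing m with
    | nil => simp
    | cons b l ih =>
      obtain ⟨m, rfl⟩ := Nat.exists_eq_add_of_lt (Nat.lt_of_lt_of_le l.length.succ_pos h)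
      rw [zero_add] at h ⊢
      simpa [List.finRange_succ, List.filterMap_map, Function.comp_def] using
        ih m (Nat.le_of_succ_le_succ h)
  exact (congrArg _ (key m s.toList (by simpa using h))).trans s.coe_toList

namespace NSST

variable (N : NSST A C)

/-- The deterministic transducer that simulates a nondeterministic one on a document in which the
variable marked at a position is the index of the transition to take there. -/
@[reducible] noncomputable def toDSST (m : ℕ) : DSST (RefSym A (Fin m)) C where
  Q := N.Q × Option (Fin m)
  R := N.R
  finQ := Fintype.ofFinite _
  Δ
    | (q, none), .opn k => some (.identity, q, some k)
    | (q, some k), .cls _ => some (.identity, q, some k)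
    | (q, some k), .letter a => (N.δ q a).toList[k.1]?.map fun p => (p.1, p.2, none)
    | _, _ => none
  copyless := by
    have copyless_identity : (Assignment.identity : Assignment N.R C).Copyless :=
      by
      rw [Assignment.copyless_iff_nodup_regs, Assignment.regs_identity]
      exact Finset.univ.nodup
    rintro ⟨q, _ | k⟩ (a | x | x) α s h
    all_goals
      simp only [Option.some.injEq, Prod.mk.injEq, reduceCtorEq, Option.map_eq_some_iff] at h
    · exact h.1 ▸ copyless_identity
    · obtain ⟨r, hr, rfl, -⟩ := h
      exact Assignment.copyless_iff_nodup_regs.2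
        (N.copyless q a r (Multiset.mem_toList.1 (List.mem_of_getElem? hr)))
    · exact h.1 ▸ copyless_identity
  q₀ := (N.q₀, none)
  F
    | (_, none) => none
    | (q, some k) => (N.F q).toList[k.1]?
  final_once := by
    rintro ⟨q, _ | k⟩ w h
    · cases h
    · exact (nodup_regs_iff w).1
        (N.final_once q w (Multiset.mem_toList.1 (List.mem_of_getElem? h)))

variable {m : ℕ}

theorem symbolicOutput_toDSST_singleton (k : Fin m) (q : N.Q) :
    (N.toDSST m).symbolicOutput (markedWord [k] []) (q, none) = (N.F q).toList[k.1]? := by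
  simp [markedWord, DSST.symbolicOutput, Assignment.apply_identity]

theorem symbolicOutput_toDSST_cons (k : Fin m) (ks : List (Fin m)) (a : A) (D : List A) (q : N.Q) :
    (N.toDSST m).symbolicOutput (markedWord (k :: ks) (a :: D)) (q, none) =
      (N.δ q a).toList[k.1]?.bind fun r =>
        ((N.toDSST m).symbolicOutput (markedWord ks D) (r.2, none)).bind r.1.apply := by
  simp [markedWord, DSST.symbolicOutput, Assignment.apply_identity, Option.bind_map]

theorem filterMap_symbolicOutput_toDSST (hδ : ∀ q a, (N.δ q a).card ≤ m)
    (hF : ∀ q, (N.F q).card ≤ m) (D : List A) (q : N.Q) :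
    ((words (Fin m) (D.length + 1)).filterMap fun ks =>
      (N.toDSST m).symbolicOutput (markedWord ks D) (q, none)) = N.symbolicOutputs D q := by
  induction D generalizing q with
  | nil =>
    simp only [List.length_nil, words, Multiset.map_singleton, Multiset.bind_singleton,
      Multiset.filterMap_map, Function.comp_def, symbolicOutput_toDSST_singleton,
      univ_filterMap_getElem? (hF q), symbolicOutputs]
  | cons a D ih =>
    rw [List.length_cons, words, Multiset.filterMap_bind, symbolicOutputs,
      ← univ_filterMap_getElem? (hδ q a), Multiset.bind_filterMap]
    refine Multiset.bind_congr fun k _ => ?_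
    simp only [Multiset.filterMap_map, Function.comp_def, symbolicOutput_toDSST_cons]
    cases (N.δ q a).toList[k.1]? with
    | none => exact Multiset.eq_zero_of_forall_notMem (by simp)
    | some r => simp [← ih, Multiset.filterMap_filterMap]

end NSST

instance {X : Type*} [Finite A] [Finite X] : Finite (RefSym A X) := by
  refine Finite.of_injective (β := A ⊕ X ⊕ X) (fun
    | .letter a => .inl a
    | .opn x => .inr (.inl x)
    | .cls x => .inr (.inr x)) fun c c' h => ?_
  cases c <;> cases c' <;> simp_all

theorem NSST.exists_program [Finite A] (N : NSST A C) : ∃ (m : ℕ) (P : Program A (Fin m) C),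
    P.IsLinear ∧ HasLinearGrowth P.T ∧ ∀ D, P.eval D = N.eval D := by
  have := Fintype.ofFinite A
  obtain ⟨K₁, hK₁⟩ := Finite.exists_le fun p : N.Q × A => (N.δ p.1 p.2).card
  obtain ⟨K₂, hK₂⟩ := Finite.exists_le fun q : N.Q => (N.F q).card
  let m := K₁ + K₂ + 1
  have hδ (q : N.Q) (a : A) : (N.δ q a).card ≤ m := (hK₁ (q, a)).trans (by omega)
  have hF (q : N.Q) : (N.F q).card ≤ m := (hK₂ q).trans (by omega)
  let R : Expr A (Fin m) := .marked 0
  have hR : R.WellFormed := Expr.wellFormed_marked _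
  refine ⟨m, ⟨languageMultispanner R.lang, (N.toDSST m).eval⟩, ⟨⟨R, hR, rfl⟩, _, rfl⟩,
    (N.toDSST m).hasLinearGrowth rfl, fun D => ?_⟩
  rw [eval_eq_filterMap_words hR rfl, ← map_map_markLabel_words, Multiset.filterMap_map]
  simp only [Function.comp_def, encodeLabels_markLabel, DSST.eval_eq_map_letters]
  rw [← Multiset.map_filterMap, N.filterMap_symbolicOutput_toDSST hδ hF, NSST.eval]

end ET

theorem mainTheorem5_general {A B C X₁ X₂ : Type*} [Finite A] [Fintype X₁] [LinearOrder X₁]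
    [Fintype X₂] [LinearOrder X₂] (P₁ : ET.Program A X₁ B) (P₂ : ET.Program B X₂ C)
    (h₁ : P₁.IsLinear) (h₂ : P₂.IsLinear) :
    ∃ (m : ℕ) (P : ET.Program A (Fin m) C), P.IsLinear ∧ ET.HasLinearGrowth P.T ∧
      ∀ D : List A, P.eval D = ET.compEval P₁ P₂ D := by
  obtain ⟨N₁, hN₁⟩ := h₁.exists_nsst
  obtain ⟨N₂, hN₂⟩ := h₂.exists_nsst
  obtain ⟨N, hN⟩ := N₁.exists_comp N₂
  obtain ⟨m, P, hP, hT, h⟩ := N.exists_program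
  refine ⟨m, P, hP, hT, fun D => ?_⟩
  rw [h, hN, hN₁, ET.compEval]
  simp only [hN₂]

theorem mainTheorem5 {A B C X₁ X₂ : Type*} [Finite A] [Finite B] [Finite C]
    [Fintype X₁] [LinearOrder X₁] [Fintype X₂] [LinearOrder X₂]
    (P₁ : ET.Program A X₁ B) (P₂ : ET.Program B X₂ C)
    (h₁ : P₁.IsLinear) (h₂ : P₂.IsLinear) :
    ∃ (m : ℕ) (P : ET.Program A (Fin m) C), P.IsLinear ∧ ET.HasLinearGrowth P.T ∧
      ∀ D : List A, P.eval D = ET.compEval P₁ P₂ D :=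
  mainTheorem5_general P₁ P₂ h₁ h₂
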